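/- Let $\mathcal G$ be a connected abelian Lie group of dimension $N\ge 1$ with Lie algebra $\mathfrak g$, and let $B$ be a connected oriented smooth surface. Let $\pi:M\to B$ be a twisted principal $\mathcal G$-bundle, i.e. a smooth fiber bundle with fiber $\mathcal G$ and structure group $\mathcal G\rtimes \operatorname{Aut}(\mathcal G)_\delta$, where $\operatorname{Aut}(\mathcal G)_\delta$ is the automorphism group with the discrete topology and $(s,a)$ acts on $\mathcal G$ by $x\mapsto s+a(x)$. The locally constant automorphism parts of the transition functions, acting on $\mathfrak g$ by their differentials, define a flat vector bundle $e\to B$ with fiber $\mathfrak g\cong\mathbb R^N$. Assume that $e$ has holonomy in $\det^{-1}(\pm1)\subset \operatorname{GL}(N,\mathbb R)$, and accordingly use local trivializations of $M$ for which the transition functions of $e$ have determinant $\pm 1$. Let $\overline g$ be a smooth Riemannian metric on $M$ for which the free local $\mathcal G$-actions are isometric. In adapted local coordinates (coordinates $b^\alpha$ on $B$ and linear coordinates $x^I$ on the fibers, given by a local trivialization and a fixed basis of $\mathfrak g$) write $$\overline g=\sum_{I,J=1}^N G_{IJ}\,(dx^I+A^I)(dx^J+A^J)+\sum_{\alpha,\beta=1}^2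 g_{\alpha\beta}\,db^\alpha db^\beta ,$$ where $G_{IJ}$, $A^I=A^I_\alpha db^\alpha$ and $g_{\alpha\beta}$ depend only on the point of $B$; put $F^I_{\alpha\beta}=\partial_\alpha A^I_\beta-\partial_\beta A^I_\alpha$, and let $\operatorname{dvol}_B$ be the area form of the metric $g_B=(g_{\alpha\beta})$ on the oriented surface $B$. The mixed Ricci equation is the equation $\operatorname{Ric}_{\overline g}(V,X)=0$ for all vertical vectors $V$ and all horizontal ($\overline g$-orthogonal to the fibers) vectors $X$ at the same point of $M$; at a point where $A=0$ it says that the components $\overline R_{I\alpha}$ vanish. (1) The mixed Ricci equation holds on $M$ if and only if $\sqrt{\det G}\;G_{IJ}\,\dfrac{F^J}{\operatorname{dvol}_B}$ defines a flat section of the dual bundle $e^*$. (2) Suppose that $\overline g$ is Einstein, $\operatorname{Ric}_{\overline g}=\lambda\overline g$ for some $\lambda\in\mathbb R$. Then the mixed Ricci equation holds. If moreover, for some basepoint $b_0\in B$, the monodromy representation $\rho$ of $\pi_1(B,b_0)$ on the fiber of $e^*$ over $b_0$ does not have a trivial one-dimensional subrepresentation, then $F=0$. -/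

import Mathlib

open scoped Manifold ContDiff Topology

/-! ### Metrics and Ricci curvature in local coordinates

Coordinates are labelled by an arbitrary finite type `κ`, so that the coordinate space is `κ → ℝ`. -/

section Coordinates

variable {κ : Type*} [Fintype κ] [DecidableEq κ]

/-- The partial derivative `∂_k f` at `z`. -/
noncomputable def pd (k : κ) (f : (κ → ℝ) → ℝ) (z : κ → ℝ) : ℝ :=
  fderiv ℝ f z (Pi.single k 1)

/-- The Christoffel symbol `Γ^k_{ij}` of a metric `h_{ij}` given in local coordinates. -/
noncomputable def christoffel (h : (κ → ℝ) → Matrix κ κ ℝ) (k i j : κ) (z : κ → ℝ) : ℝ :=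
  (1 / 2) * ∑ l, (h z)⁻¹ k l *
    (pd i (fun w => h w j l) z + pd j (fun w => h w i l) z - pd l (fun w => h w i j) z)

/-- The component `R_{ij} = ∂_k Γ^k_{ij} - ∂_j Γ^k_{ik} + Γ^k_{kl} Γ^l_{ij} - Γ^k_{jl} Γ^l_{ik}`
of the Ricci tensor of a metric `h_{ij}` given in local coordinates. -/
noncomputable def ricci (h : (κ → ℝ) → Matrix κ κ ℝ) (i j : κ) (z : κ → ℝ) : ℝ :=
  (∑ k, pd k (christoffel h k i j) z) - (∑ k, pd j (christoffel h k i k) z)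
    + (∑ k, ∑ l, christoffel h k k l z * christoffel h l i j z)
    - ∑ k, ∑ l, christoffel h k j l z * christoffel h l i k z

end Coordinates

section Manifold

variable {m : ℕ} {M : Type*} [TopologicalSpace M] [ChartedSpace (EuclideanSpace ℝ (Fin m)) M]
  [IsManifold (𝓡 m) ∞ M]

variable (m M) in
/-- Smooth Riemannian metrics on the `m`-dimensional manifold `M`. -/
abbrev SmoothMetric : Type _ :=
  Bundle.ContMDiffRiemannianMetric (𝓡 m) ∞ (EuclideanSpace ℝ (Fin m))
    (fun p : M => TangentSpace (𝓡 m) p)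

variable {κ : Type*} [Fintype κ] [DecidableEq κ]

/-- The components of the Riemannian metric `gbar` in the coordinates given by the local
parametrization `ψ` of `M`: `h_{kl} = gbar(∂_k ψ, ∂_l ψ)`. -/
noncomputable def coordMetric (gbar : SmoothMetric m M) (ψ : (κ → ℝ) → M) (z : κ → ℝ) :
    Matrix κ κ ℝ :=
  Matrix.of fun k l => gbar.inner (ψ z) (mfderiv 𝓘(ℝ, κ → ℝ) (𝓡 m) ψ z (Pi.single k 1 : κ → ℝ))
    (mfderiv 𝓘(ℝ, κ → ℝ) (𝓡 m) ψ z (Pi.single l 1 : κ → ℝ))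

/-- `Ric(gbar) = lam • gbar` on `M`: the equation holds in all smooth local coordinates, that is,
for every smooth `ψ` from an open set `Ω` of `ℝ^m` to `M` with invertible differentials. -/
def IsEinstein (gbar : SmoothMetric m M) (lam : ℝ) : Prop :=
  ∀ (κ : Type) [Fintype κ] [DecidableEq κ], Fintype.card κ = m →
    ∀ (Ω : Set (κ → ℝ)) (ψ : (κ → ℝ) → M), IsOpen Ω →
      ContMDiffOn 𝓘(ℝ, κ → ℝ) (𝓡 m) ∞ ψ Ω →
      (∀ z ∈ Ω, Function.Bijective (mfderiv 𝓘(ℝ, κ → ℝ) (𝓡 m) ψ z)) →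
      ∀ z ∈ Ω, ∀ k l : κ,
        ricci (coordMetric gbar ψ) k l z = lam * coordMetric gbar ψ z k l

variable (m M) in
/-- An orientation of `M`, given by an oriented atlas: a set of smooth charts that cover `M` and
whose coordinate changes have positive Jacobian determinant. -/
structure OrientedAtlas where
  /-- the positively oriented charts -/
  charts : Set (OpenPartialHomeomorph M (EuclideanSpace ℝ (Fin m)))
  subset_maximalAtlas : charts ⊆ IsManifold.maximalAtlas (𝓡 m) ∞ M
  exists_mem_source : ∀ b : M, ∃ β ∈ charts, b ∈ β.source
  det_pos : ∀ β ∈ charts, ∀ β' ∈ charts, ∀ y ∈ (β.symm.trans β').source,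
    0 < (fderiv ℝ (β' ∘ β.symm) y).det

end Manifold

/-! ### Twisted principal bundles -/

/-- A twisted principal `𝒢`-bundle `proj : M → B` over an `n`-dimensional manifold, for an
`N`-dimensional abelian Lie group `𝒢` (written additively): a smooth fiber bundle with fiber `𝒢`
and structure group `𝒢 ⋊ Aut(𝒢)_δ`, where `Aut(𝒢)_δ` is the automorphism group with the discrete
topology and `(s, a)` acts on `𝒢` by `x ↦ s + a x`. -/
structure TwistedBundle (ι : Type*) (n N : ℕ) (B 𝒢 M : Type*)
    [TopologicalSpace B] [ChartedSpace (EuclideanSpace ℝ (Fin n)) B]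
    [AddCommGroup 𝒢] [TopologicalSpace 𝒢] [ChartedSpace (EuclideanSpace ℝ (Fin N)) 𝒢]
    [TopologicalSpace M] [ChartedSpace (EuclideanSpace ℝ (Fin (n + N))) M] where
  /-- the bundle projection -/
  proj : M → B
  /-- the local trivializations -/
  triv : ι → Bundle.Trivialization 𝒢 proj
  exists_mem_baseSet : ∀ b : B, ∃ i, b ∈ (triv i).baseSet
  contMDiffOn_triv : ∀ i, ContMDiffOn (𝓡 (n + N)) ((𝓡 n).prod (𝓡 N)) ∞ (triv i) (triv i).source
  contMDiffOn_triv_symm : ∀ i, ContMDiffOn ((𝓡 n).prod (𝓡 N)) (𝓡 (n + N)) ∞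
    (triv i).toOpenPartialHomeomorph.symm (triv i).target
  /-- the translation part of the coordinate changes -/
  shift : ι → ι → B → 𝒢
  contMDiffOn_shift : ∀ i j, ContMDiffOn (𝓡 n) (𝓡 N) ∞ (shift i j)
    ((triv i).baseSet ∩ (triv j).baseSet)
  /-- the automorphism part of the coordinate changes -/
  aut : ι → ι → B → (𝒢 ≃+ 𝒢)
  contMDiff_aut : ∀ i j b, b ∈ (triv i).baseSet ∩ (triv j).baseSet →
    ContMDiff (𝓡 N) (𝓡 N) ∞ (aut i j b) ∧ ContMDiff (𝓡 N) (𝓡 N) ∞ (aut i j b).symm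
  aut_locallyConstant : ∀ i j b, b ∈ (triv i).baseSet ∩ (triv j).baseSet →
    ∀ᶠ b' in 𝓝 b, aut i j b' = aut i j b
  transition : ∀ i j b, b ∈ (triv i).baseSet ∩ (triv j).baseSet → ∀ x : 𝒢,
    (triv j).toOpenPartialHomeomorph.symm (b, x)
      = (triv i).toOpenPartialHomeomorph.symm (b, shift i j b + aut i j b x)

namespace TwistedBundle

variable {ι : Type*} {n N : ℕ} {B 𝒢 M : Type*}
  [TopologicalSpace B] [ChartedSpace (EuclideanSpace ℝ (Fin n)) B]
  [AddCommGroup 𝒢] [TopologicalSpace 𝒢] [ChartedSpace (EuclideanSpace ℝ (Fin N)) 𝒢]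
  [TopologicalSpace M] [ChartedSpace (EuclideanSpace ℝ (Fin (n + N))) M]

/-! #### The flat vector bundles `e` and `e*`

The Lie algebra of `𝒢` is the tangent space at `0`, which is `ℝ^N`. The flat vector bundle `e` has
fiber this Lie algebra and the differentials of the automorphisms `aut i j b` as its locally
constant transition functions. -/

/-- The transition function of `e` from the trivialization `j` to the trivialization `i`. -/
noncomputable def linAut (P : TwistedBundle ι n N B 𝒢 M) (i j : ι) (b : B) :
    EuclideanSpace ℝ (Fin N) →L[ℝ] EuclideanSpace ℝ (Fin N) :=
  mfderiv (𝓡 N) (𝓡 N) (P.aut i j b) (0 : 𝒢)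

/-- The structure group of the flat vector bundle `e` is `det⁻¹(± 1)`. -/
def HasDetOne (P : TwistedBundle ι n N B 𝒢 M) : Prop :=
  ∀ i j b, b ∈ (P.triv i).baseSet ∩ (P.triv j).baseSet → |(P.linAut i j b).det| = 1

/-- A flat section of `e*`, written in the local trivializations: `σ i b` is the value at `b` in
the trivialization `i`; these values match on overlaps and are locally constant. -/
structure IsFlatSection (P : TwistedBundle ι n N B 𝒢 M)
    (σ : ι → B → Module.Dual ℝ (EuclideanSpace ℝ (Fin N))) : Prop where
  compatible : ∀ i j b, b ∈ (P.triv i).baseSet ∩ (P.triv j).baseSet →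
    σ j b = σ i b ∘ₗ (P.linAut i j b : EuclideanSpace ℝ (Fin N) →ₗ[ℝ] EuclideanSpace ℝ (Fin N))
  locallyConstant : ∀ i, ∀ b ∈ (P.triv i).baseSet, ∀ᶠ b' in 𝓝 b, σ i b' = σ i b

/-- A parallel section of `e*` along the path `γ`, written in the local trivializations. -/
structure IsParallelAlong (P : TwistedBundle ι n N B 𝒢 M) {b₀ b₁ : B} (γ : Path b₀ b₁)
    (σ : ι → unitInterval → Module.Dual ℝ (EuclideanSpace ℝ (Fin N))) : Prop where
  compatible : ∀ i j t, γ t ∈ (P.triv i).baseSet ∩ (P.triv j).baseSet →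
    σ j t = σ i t ∘ₗ
      (P.linAut i j (γ t) : EuclideanSpace ℝ (Fin N) →ₗ[ℝ] EuclideanSpace ℝ (Fin N))
  locallyConstant : ∀ i t, γ t ∈ (P.triv i).baseSet → ∀ᶠ s in 𝓝 t, σ i s = σ i t

/-- Identify the fiber of `e*` over `b₀` with the dual of `ℝ^N` by the trivialization `i`. The
monodromy of `e*` along the loop `γ` at `b₀` maps `v` to `w`. -/
def Monodromy (P : TwistedBundle ι n N B 𝒢 M) (i : ι) {b₀ : B} (γ : Path b₀ b₀)
    (v w : Module.Dual ℝ (EuclideanSpace ℝ (Fin N))) : Prop :=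
  ∃ σ : ι → unitInterval → Module.Dual ℝ (EuclideanSpace ℝ (Fin N)),
    P.IsParallelAlong γ σ ∧ σ i 0 = v ∧ σ i 1 = w

/-- The monodromy representation of `e*` at the basepoint `b₀` (whose fiber is identified with the
dual of `ℝ^N` by the trivialization `i`) has a trivial one-dimensional subrepresentation: there is
a line on which the monodromy along every loop is the identity. -/
def HasTrivialLine (P : TwistedBundle ι n N B 𝒢 M) (i : ι) (b₀ : B) : Prop :=
  ∃ W : Submodule ℝ (Module.Dual ℝ (EuclideanSpace ℝ (Fin N))), Module.finrank ℝ W = 1 ∧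
    ∀ γ : Path b₀ b₀, ∀ v ∈ W, P.Monodromy i γ v v

/-! #### Invariant metrics and adapted coordinates -/

variable [IsManifold (𝓡 (n + N)) ∞ M]

/-- The action of `x : 𝒢` on the part of `M` over the domain of the trivialization `i`. -/
noncomputable def act (P : TwistedBundle ι n N B 𝒢 M) (i : ι) (x : 𝒢) (p : M) : M :=
  (P.triv i).toOpenPartialHomeomorph.symm ((P.triv i p).1, (P.triv i p).2 + x)

/-- The free local `𝒢`-actions on `M` are isometric. -/
def IsInvariant (P : TwistedBundle ι n N B 𝒢 M) (gbar : SmoothMetric (n + N) M) : Prop :=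
  ∀ (i : ι) (x : 𝒢), ∀ p ∈ (P.triv i).source, ∀ u v : TangentSpace (𝓡 (n + N)) p,
    gbar.inner (P.act i x p) (mfderiv (𝓡 (n + N)) (𝓡 (n + N)) (P.act i x) p u)
      (mfderiv (𝓡 (n + N)) (𝓡 (n + N)) (P.act i x) p v) = gbar.inner p u v

/-- Adapted local coordinates `(b^α, x^I)` on `M`: a trivialization, coordinates on the base, and
linear coordinates on the group. The latter are given by the homomorphism `lin : ℝ^N → 𝒢` whose
differential at `0` is the identity, that is, by the exponential map of `𝒢`. -/
structure AdaptedCoords [IsManifold (𝓡 n) ∞ B] (P : TwistedBundle ι n N B 𝒢 M) where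
  /-- the trivialization -/
  idx : ι
  /-- the chart of the base -/
  chart : OpenPartialHomeomorph B (EuclideanSpace ℝ (Fin n))
  chart_mem : chart ∈ IsManifold.maximalAtlas (𝓡 n) ∞ B
  /-- the linear coordinates on the group -/
  lin : EuclideanSpace ℝ (Fin N) →+ 𝒢
  contMDiff_lin : ContMDiff (𝓡 N) (𝓡 N) ∞ lin
  mfderiv_lin : ∀ v : EuclideanSpace ℝ (Fin N), mfderiv (𝓡 N) (𝓡 N) lin 0 v = v

namespace AdaptedCoords

variable [IsManifold (𝓡 n) ∞ B] {P : TwistedBundle ι n N B 𝒢 M}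

/-- The point of `B` with coordinates `y`. -/
noncomputable def point (C : P.AdaptedCoords) (y : Fin n → ℝ) : B :=
  C.chart.symm (WithLp.toLp 2 y)

/-- The coordinates of the points of the base that are covered by the adapted coordinates. -/
def domain (C : P.AdaptedCoords) : Set (Fin n → ℝ) :=
  {y | WithLp.toLp 2 y ∈ C.chart.target ∧ C.point y ∈ (P.triv C.idx).baseSet}

/-- The local parametrization `(b^α, x^I) ↦ M`. -/
noncomputable def param (C : P.AdaptedCoords) (z : Fin n ⊕ Fin N → ℝ) : M :=
  (P.triv C.idx).toOpenPartialHomeomorph.symm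
    (C.point (fun α => z (Sum.inl α)), C.lin (WithLp.toLp 2 fun I => z (Sum.inr I)))

/-- The components of the metric on `M` in the adapted coordinates at the point `(y, 0)`; by
invariance they do not change along the fiber. -/
noncomputable def metric (C : P.AdaptedCoords) (gbar : SmoothMetric (n + N) M)
    (y : Fin n → ℝ) : Matrix (Fin n ⊕ Fin N) (Fin n ⊕ Fin N) ℝ :=
  coordMetric gbar C.param (Sum.elim y 0)

/-! The functions `G_{IJ}`, `A^I_α` and `g_{αβ}` in
`gbar = G_{IJ} (dx^I + A^I) (dx^J + A^J) + g_{αβ} db^α db^β`. -/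

/-- The inner product `G_{IJ}` on `e`. -/
noncomputable def G (C : P.AdaptedCoords) (gbar : SmoothMetric (n + N) M) (y : Fin n → ℝ) :
    Matrix (Fin N) (Fin N) ℝ :=
  (C.metric gbar y).toBlocks₂₂

/-- The connection `A^I_α`; it is determined by `gbar_{Iα} = G_{IJ} A^J_α`. -/
noncomputable def A (C : P.AdaptedCoords) (gbar : SmoothMetric (n + N) M) (y : Fin n → ℝ) :
    Matrix (Fin N) (Fin n) ℝ :=
  (C.G gbar y)⁻¹ * (C.metric gbar y).toBlocks₂₁

/-- The metric `g_{αβ}` on `B`; it is determined by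
`gbar_{αβ} = g_{αβ} + G_{IJ} A^I_α A^J_β`. -/
noncomputable def g (C : P.AdaptedCoords) (gbar : SmoothMetric (n + N) M) (y : Fin n → ℝ) :
    Matrix (Fin n) (Fin n) ℝ :=
  (C.metric gbar y).toBlocks₁₁ - (C.A gbar y).transpose * C.G gbar y * C.A gbar y

/-- The curvature `F^I_{αβ} = ∂_α A^I_β - ∂_β A^I_α`. -/
noncomputable def F (C : P.AdaptedCoords) (gbar : SmoothMetric (n + N) M) (I : Fin N)
    (α β : Fin n) (y : Fin n → ℝ) : ℝ :=
  pd α (fun w => C.A gbar w I β) y - pd β (fun w => C.A gbar w I α) y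

end AdaptedCoords

/-- The curvature `F` vanishes. -/
def CurvatureVanishes [IsManifold (𝓡 n) ∞ B] (P : TwistedBundle ι n N B 𝒢 M)
    (gbar : SmoothMetric (n + N) M) : Prop :=
  ∀ C : P.AdaptedCoords, ∀ y ∈ C.domain, ∀ I α β, C.F gbar I α β y = 0

/-- The mixed Ricci equation: in adapted coordinates, `Ric(∂_I, X_α) = 0`, where
`X_α = ∂_α - A^J_α ∂_J` is the horizontal lift of `∂_α`. At points where `A = 0` this says that
the component `R_{Iα}` vanishes. -/
def MixedRicciEquation [IsManifold (𝓡 n) ∞ B] (P : TwistedBundle ι n N B 𝒢 M)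
    (gbar : SmoothMetric (n + N) M) : Prop :=
  ∀ C : P.AdaptedCoords, ∀ y ∈ C.domain, ∀ (x : Fin N → ℝ) (I : Fin N) (α : Fin n),
    ricci (coordMetric gbar C.param) (Sum.inr I) (Sum.inl α) (Sum.elim y x)
      - ∑ J, C.A gbar y J α *
          ricci (coordMetric gbar C.param) (Sum.inr I) (Sum.inr J) (Sum.elim y x) = 0

end TwistedBundle

/-! ### The conserved quantity over an oriented two-dimensional base -/

namespace TwistedBundle

variable {ι : Type*} {N : ℕ} {B 𝒢 M : Type*}
  [TopologicalSpace B] [ChartedSpace (EuclideanSpace ℝ (Fin 2)) B] [IsManifold (𝓡 2) ∞ B]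
  [AddCommGroup 𝒢] [TopologicalSpace 𝒢] [ChartedSpace (EuclideanSpace ℝ (Fin N)) 𝒢]
  [TopologicalSpace M] [ChartedSpace (EuclideanSpace ℝ (Fin (2 + N))) M]
  [IsManifold (𝓡 (2 + N)) ∞ M]

/-- The components `√(det G) G_{IJ} F^J / dvol_B` in positively oriented adapted coordinates, in
which `dvol_B = √(det g) db¹ ∧ db²` and `F^J = F^J_{12} db¹ ∧ db²`. -/
noncomputable def AdaptedCoords.twist {P : TwistedBundle ι 2 N B 𝒢 M} (C : P.AdaptedCoords)
    (gbar : SmoothMetric (2 + N) M) (I : Fin N) (y : Fin 2 → ℝ) : ℝ :=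
  √(C.G gbar y).det * ∑ J, C.G gbar y I J * (C.F gbar J 0 1 y / √(C.g gbar y).det)

/-- `√(det G) G_{IJ} F^J / dvol_B` defines a flat section of `e*`. -/
def TwistIsFlat (P : TwistedBundle ι 2 N B 𝒢 M) (o : OrientedAtlas 2 B)
    (gbar : SmoothMetric (2 + N) M) : Prop :=
  ∃ σ : ι → B → Module.Dual ℝ (EuclideanSpace ℝ (Fin N)), P.IsFlatSection σ ∧
    ∀ C : P.AdaptedCoords, C.chart ∈ o.charts → ∀ y ∈ C.domain, ∀ I,
      σ C.idx (C.point y) (EuclideanSpace.single I 1) = C.twist gbar I y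

end TwistedBundle

/-! In adapted coordinates every vertical field `∂_I` is Killing. For a Killing coordinate field
with dual one-form `ξ = h_{Ia} dz^a`, the Ricci form `R_{Ij}` is a divergence: `√det h R_{Ij} = ∂_k
(√det h V^{kp}) h_{pj}`, where `V` is half of `dξ` with both indices raised
(`sqrt_det_mul_ricci_of_killing`). Contracting `j` with the horizontal lift `X_α` replaces `h_{pj}`
by `g_{βα}`, so only the base components `V^{kβ}` enter, and their vertical derivatives vanish by
invariance.

Since `ξ = G_{IJ} (dx^J + A^J)`, the value of `dξ` on two horizontal vectors is `G_{IJ} F^J`. Over a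
surface a bivector has one component: raising its two indices divides by `det g`, and `√det h = √det
G √det g`, so `√det h V^{γβ}` is a constant antisymmetric matrix times the twist `√det G G_{IJ} F^J
/ dvol`. Hence the mixed Ricci equation says exactly that the twist has zero derivative in every
adapted coordinate system (`mixedRicci_iff_pd_kkTwist`, `mixedRicciEquation_iff_pd_twist`).

It remains to see that the local twists form a section of `e*`. Two adapted coordinate systems
differ by a base change `φ`, an affine fiber change with linear part `L`, and a local isometry.
Under this change `F` acquires `L⁻¹ det Dφ`, `G` becomes `Lᵀ G L`, and `dvol` acquires `|det Dφ|`.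
As `|det L| = 1`, the twist is multiplied by `Lᵀ` and by the sign of `det Dφ`
(`kkTwist_coordinate_change`, `twist_change`); the sign is `1` between oriented charts and locally
constant in general.

For an Einstein metric, `Ric(V, X) = λ h(V, X) = 0`. The resulting flat section, if nonzero at the
basepoint, would span a trivial line for the monodromy; so it vanishes there, hence everywhere by
connectedness, and `F = 0` because `G` is invertible. -/

set_option linter.unusedSectionVars false

/-! ### Calculus of partial derivatives and determinants -/

section CoordinateCalculus

variable {κ : Type*} [Fintype κ] [DecidableEq κ]

lemma pd_add {f g : (κ → ℝ) → ℝ} {z : κ → ℝ} (k : κ) (hf : DifferentiableAt ℝ f z)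
    (hg : DifferentiableAt ℝ g z) : pd k (fun w => f w + g w) z = pd k f z + pd k g z := by
  simp only [pd]; rw [fderiv_fun_add hf hg]; rfl

lemma pd_mul {f g : (κ → ℝ) → ℝ} {z : κ → ℝ} (k : κ) (hf : DifferentiableAt ℝ f z)
    (hg : DifferentiableAt ℝ g z) :
    pd k (fun w => f w * g w) z = pd k f z * g z + f z * pd k g z := by
  simp only [pd]; rw [fderiv_fun_mul hf hg]; simp; ring

lemma pd_const_mul {f : (κ → ℝ) → ℝ} {z : κ → ℝ} (k : κ) (c : ℝ) (hf : DifferentiableAt ℝ f z) :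
    pd k (fun w => c * f w) z = c * pd k f z := by
  simp only [pd]; rw [fderiv_const_mul hf]; simp

lemma pd_sum {ι : Type*} {s : Finset ι} {f : ι → (κ → ℝ) → ℝ} {z : κ → ℝ} (k : κ)
    (hf : ∀ i ∈ s, DifferentiableAt ℝ (f i) z) :
    pd k (fun w => ∑ i ∈ s, f i w) z = ∑ i ∈ s, pd k (f i) z := by
  simp only [pd]; rw [fderiv_fun_sum hf]; simp

lemma pd_const (k : κ) (c : ℝ) (z : κ → ℝ) : pd k (fun _ => c) z = 0 := by
  simp [pd]

lemma Filter.EventuallyEq.pd_eq {f g : (κ → ℝ) → ℝ} {z : κ → ℝ} (h : f =ᶠ[𝓝 z] g) (k : κ) :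
    pd k f z = pd k g z := by
  simp only [pd]; rw [h.fderiv_eq]

lemma ContDiffAt.pd {f : (κ → ℝ) → ℝ} {z : κ → ℝ} (hf : ContDiffAt ℝ ∞ f z) (k : κ) :
    ContDiffAt ℝ ∞ (pd k f) z :=
  (hf.fderiv_right (m := ∞) (by simp)).clm_apply contDiffAt_const

lemma fderiv_eq_zero_of_pd {f : (κ → ℝ) → ℝ} {z : κ → ℝ} (h : ∀ k, pd k f z = 0) :
    fderiv ℝ f z = 0 := by
  ext v
  have : v = ∑ k, v k • (Pi.single k 1 : κ → ℝ) := by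
    ext i; simp [Finset.sum_apply, Pi.single_apply]
  rw [this, map_sum]
  simp only [map_smul]
  exact Finset.sum_eq_zero fun k _ => by
    have := h k
    simp only [_root_.pd] at this
    simp [this]

variable {E : Type*} [NormedAddCommGroup E] [NormedSpace ℝ E] {m : Type*} [Fintype m]
  [DecidableEq m] {r : WithTop ℕ∞}

lemma ContDiffAt.matrix_det {h : E → Matrix m m ℝ} {z : E}
    (hh : ∀ i j, ContDiffAt ℝ r (fun w => h w i j) z) : ContDiffAt ℝ r (fun w => (h w).det) z := by
  simp only [Matrix.det_apply]
  exact ContDiffAt.sum fun σ _ => (contDiffAt_prod fun i _ => hh _ _).const_smul _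

lemma ContDiffAt.matrix_inv_apply {h : E → Matrix m m ℝ} {z : E}
    (hh : ∀ i j, ContDiffAt ℝ r (fun w => h w i j) z) (hd : (h z).det ≠ 0) (i j : m) :
    ContDiffAt ℝ r (fun w => (h w)⁻¹ i j) z := by
  simp only [Matrix.inv_def, Matrix.smul_apply, Matrix.adjugate_apply, smul_eq_mul,
    Ring.inverse_eq_inv']
  refine ((ContDiffAt.matrix_det hh).inv hd).mul (ContDiffAt.matrix_det fun a b => ?_)
  simp only [Matrix.updateRow_apply]
  split_ifs
  · exact contDiffAt_const
  · exact hh _ _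

/-- Jacobi's formula for the derivative of a determinant. -/
lemma pd_det {h : (κ → ℝ) → Matrix m m ℝ} {z : κ → ℝ} (k : κ)
    (hh : ∀ i j, DifferentiableAt ℝ (fun w => h w i j) z) (hd : (h z).det ≠ 0) :
    pd k (fun w => (h w).det) z
      = (h z).det * ∑ i, ∑ j, (h z)⁻¹ i j * pd k (fun w => h w j i) z := by
  let D : ContinuousMultilinearMap ℝ (fun _ : m => m → ℝ) ℝ :=
    ⟨(Matrix.detRowAlternating (n := m) (R := ℝ)).toMultilinearMap,
      Continuous.matrix_det continuous_id⟩
  have h1 : HasFDerivAt (fun w i => h w i)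
      (ContinuousLinearMap.pi fun i => ContinuousLinearMap.pi fun j =>
        fderiv ℝ (fun w => h w i j) z) z :=
    hasFDerivAt_pi.2 fun i => hasFDerivAt_pi.2 fun j => (hh i j).hasFDerivAt
  have h2 := (D.hasFDerivAt (h z)).comp z h1
  have h3 : pd k (fun w => (h w).det) z
      = ∑ i, ((h z).updateRow i (fun j => pd k (fun w => h w i j) z)).det := by
    have : (fun w => (h w).det) = (D ∘ fun w i => h w i) := rfl
    rw [pd, this, h2.fderiv]
    exact D.linearDeriv_apply (fun i => h z i) _
  rw [h3, Finset.sum_comm, Finset.mul_sum]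
  refine Finset.sum_congr rfl fun i _ => ?_
  -- By Cramer's rule, replacing row `i` by `v` gives `det h` times the `i`-th entry of `v h⁻¹`.
  rw [← Matrix.cramer_transpose_apply, ← Matrix.det_smul_inv_vecMul_eq_cramer_transpose _ _
    (isUnit_iff_ne_zero.2 hd)]
  simp only [Pi.smul_apply, smul_eq_mul, Matrix.vecMul, dotProduct]
  congr 1
  exact Finset.sum_congr rfl fun _ _ => mul_comm _ _

lemma pd_sqrt_det {h : (κ → ℝ) → Matrix m m ℝ} {z : κ → ℝ} (k : κ)
    (hh : ∀ i j, DifferentiableAt ℝ (fun w => h w i j) z)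
    (hd' : DifferentiableAt ℝ (fun w => (h w).det) z) (hd : 0 < (h z).det) :
    pd k (fun w => √(h w).det) z
      = √(h z).det * ((1 / 2) * ∑ i, ∑ j, (h z)⁻¹ i j * pd k (fun w => h w j i) z) := by
  have h1 := (hd'.hasFDerivAt.sqrt hd.ne').fderiv
  have h2 := pd_det k hh hd.ne'
  simp only [pd] at h2 ⊢
  rw [h1]
  simp only [smul_apply, h2, smul_eq_mul]
  have : √(h z).det ≠ 0 := (Real.sqrt_pos.2 hd).ne'
  field_simp
  rw [Real.sq_sqrt hd.le]

end CoordinateCalculus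

/-! ### Ricci curvature in the direction of a Killing coordinate field -/

section Killing

variable {κ : Type*} [Fintype κ] [DecidableEq κ]

/-- Half the exterior derivative of the one-form `h_{Ia} dz^a`. -/
noncomputable def halfCurl (h : (κ → ℝ) → Matrix κ κ ℝ) (I b a : κ) (w : κ → ℝ) : ℝ :=
  (1 / 2) * (pd b (fun w => h w I a) w - pd a (fun w => h w I b) w)

/-- Half the exterior derivative of `h_{Ia} dz^a`, with raised indices. -/
noncomputable def raisedCurl (h : (κ → ℝ) → Matrix κ κ ℝ) (I k p : κ) (w : κ → ℝ) : ℝ :=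
  ∑ a, ∑ b, (h w)⁻¹ k a * (h w)⁻¹ p b * halfCurl h I b a w

lemma sum_mul_eq_zero_of_antisymm {V S : κ → κ → ℝ} (hV : ∀ a b, V a b = -V b a)
    (hS : ∀ a b, S a b = S b a) : ∑ a, ∑ b, V a b * S a b = 0 := by
  have h : ∑ a, ∑ b, V a b * S a b = -∑ a, ∑ b, V a b * S a b := by
    conv_lhs => rw [Finset.sum_comm]
    rw [← Finset.sum_neg_distrib]
    refine Finset.sum_congr rfl fun a _ => ?_
    rw [← Finset.sum_neg_distrib]
    refine Finset.sum_congr rfl fun b _ => ?_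
    rw [hV b a, hS b a]; ring
  linarith

lemma raisedCurl_antisymm (h : (κ → ℝ) → Matrix κ κ ℝ) (I k p : κ) (w : κ → ℝ) :
    raisedCurl h I k p w = -raisedCurl h I p k w := by
  simp only [raisedCurl, halfCurl]
  rw [Finset.sum_comm, ← Finset.sum_neg_distrib]
  refine Finset.sum_congr rfl fun a _ => ?_
  rw [← Finset.sum_neg_distrib]
  refine Finset.sum_congr rfl fun b _ => ?_
  ring

variable {h : (κ → ℝ) → Matrix κ κ ℝ} {w : κ → ℝ}

lemma sum_inv_mul (hd : (h w).det ≠ 0) (i j : κ) :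
    ∑ k, (h w)⁻¹ i k * h w k j = if i = j then 1 else 0 := by
  have := congrFun (congrFun (Matrix.nonsing_inv_mul (h w) (isUnit_iff_ne_zero.2 hd)) i) j
  rwa [Matrix.mul_apply, Matrix.one_apply] at this

lemma sum_mul_inv (hd : (h w).det ≠ 0) (i j : κ) :
    ∑ k, h w i k * (h w)⁻¹ k j = if i = j then 1 else 0 := by
  have := congrFun (congrFun (Matrix.mul_nonsing_inv (h w) (isUnit_iff_ne_zero.2 hd)) i) j
  rwa [Matrix.mul_apply, Matrix.one_apply] at this

lemma inv_symm_apply (hs : (h w).IsSymm) (i j : κ) : (h w)⁻¹ i j = (h w)⁻¹ j i :=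
  hs.inv.apply _ _

lemma sum_raisedCurl_mul (hs : (h w).IsSymm) (hd : (h w).det ≠ 0) (I k j : κ) :
    ∑ p, raisedCurl h I k p w * h w p j = ∑ a, (h w)⁻¹ k a * halfCurl h I j a w := by
  simp only [raisedCurl, Finset.sum_mul]
  rw [Finset.sum_comm]
  refine Finset.sum_congr rfl fun a _ => ?_
  rw [Finset.sum_comm]
  have : ∀ b, ∑ p, (h w)⁻¹ k a * (h w)⁻¹ p b * halfCurl h I b a w * h w p j
      = (h w)⁻¹ k a * halfCurl h I b a w * (if b = j then 1 else 0) := fun b => by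
    rw [← sum_inv_mul hd, Finset.mul_sum]
    refine Finset.sum_congr rfl fun p _ => ?_
    rw [inv_symm_apply hs p b]; ring
  simp [this]

/-- Once `∂_I h` drops out, the Christoffel bracket that remains is the curl of `h_{Ia} dz^a`: the
covariant derivative of a Killing field is antisymmetric. -/
lemma christoffel_of_killing (hs : (h w).IsSymm) (hd : (h w).det ≠ 0) {I : κ}
    (hK : ∀ i j, pd I (fun w => h w i j) w = 0) (k j : κ) :
    christoffel h k I j w = ∑ p, raisedCurl h I k p w * h w p j := by
  rw [sum_raisedCurl_mul hs hd]
  simp only [christoffel, halfCurl, hK, Finset.mul_sum]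
  refine Finset.sum_congr rfl fun a _ => ?_
  ring

variable {z : κ → ℝ}

lemma pd_symm (hs : ∀ᶠ w in 𝓝 z, (h w).IsSymm) (k i j : κ) :
    pd k (fun w => h w i j) z = pd k (fun w => h w j i) z :=
  Filter.EventuallyEq.pd_eq (hs.mono fun _ hw => (hw.apply j i)) k

/-- The two other terms of the Christoffel symbol are antisymmetric in the contracted indices. What
is left is the logarithmic derivative of `√det h` found in `pd_sqrt_det`. -/
lemma sum_christoffel_contract (hs : ∀ᶠ w in 𝓝 z, (h w).IsSymm) (l : κ) :
    ∑ k, christoffel h k k l z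
      = (1 / 2) * ∑ k, ∑ m, (h z)⁻¹ k m * pd l (fun w => h w m k) z := by
  simp only [christoffel, ← Finset.mul_sum]
  congr 1
  rw [← sub_eq_zero, ← Finset.sum_sub_distrib]
  simp only [← Finset.sum_sub_distrib]
  have hinv := fun i j => inv_symm_apply hs.self_of_nhds i j
  have : ∀ k m, (h z)⁻¹ k m * (pd k (fun w => h w l m) z + pd l (fun w => h w k m) z
      - pd m (fun w => h w k l) z) - (h z)⁻¹ k m * pd l (fun w => h w m k) z
      = (pd k (fun w => h w m l) z - pd m (fun w => h w k l) z) * (h z)⁻¹ k m := fun k m => by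
    rw [pd_symm hs k l m, pd_symm hs l m k]; ring
  simp only [this]
  exact sum_mul_eq_zero_of_antisymm (fun a b => by ring) hinv

lemma sum_mul_christoffel (hd : (h z).det ≠ 0) (p i j : κ) :
    ∑ k, h z p k * christoffel h k i j z
      = (1 / 2) * (pd i (fun w => h w j p) z + pd j (fun w => h w i p) z
        - pd p (fun w => h w i j) z) := by
  simp only [christoffel, Finset.mul_sum]
  rw [Finset.sum_comm]
  have : ∀ l, ∑ k, h z p k * (1 / 2 * ((h z)⁻¹ k l *
      (pd i (fun w => h w j l) z + pd j (fun w => h w i l) z - pd l (fun w => h w i j) z)))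
      = (if p = l then 1 else 0) * (1 / 2 * (pd i (fun w => h w j l) z + pd j (fun w => h w i l) z
        - pd l (fun w => h w i j) z)) := fun l => by
    rw [← sum_mul_inv hd, Finset.sum_mul]
    exact Finset.sum_congr rfl fun k _ => by ring
  rw [Finset.sum_congr rfl fun l _ => this l]
  simp

lemma ContDiffAt.christoffel (hh : ∀ i j, ContDiffAt ℝ ∞ (fun w => h w i j) z)
    (hd : (h z).det ≠ 0) (k i j : κ) : ContDiffAt ℝ ∞ (christoffel h k i j) z :=
  contDiffAt_const.mul <| ContDiffAt.sum fun _ _ => (ContDiffAt.matrix_inv_apply hh hd _ _).mul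
    ((((hh _ _).pd _).add ((hh _ _).pd _)).sub ((hh _ _).pd _))

lemma ContDiffAt.raisedCurl (hh : ∀ i j, ContDiffAt ℝ ∞ (fun w => h w i j) z)
    (hd : (h z).det ≠ 0) (I k p : κ) : ContDiffAt ℝ ∞ (raisedCurl h I k p) z :=
  ContDiffAt.sum fun _ _ => ContDiffAt.sum fun _ _ =>
    ((ContDiffAt.matrix_inv_apply hh hd _ _).mul (ContDiffAt.matrix_inv_apply hh hd _ _)).mul
      (contDiffAt_const.mul (((hh _ _).pd _).sub ((hh _ _).pd _)))

/-- If `∂_I` is a Killing field, then `R_{Ij}` is the divergence of the antisymmetric tensor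
`raisedCurl h I`. -/
theorem sqrt_det_mul_ricci_of_killing (hh : ∀ i j, ContDiffAt ℝ ∞ (fun w => h w i j) z)
    (hs : ∀ᶠ w in 𝓝 z, (h w).IsSymm) (hd : 0 < (h z).det) {I : κ}
    (hK : ∀ᶠ w in 𝓝 z, ∀ i j, pd I (fun w => h w i j) w = 0) (j : κ) :
    √(h z).det * ricci h I j z
      = ∑ p, (∑ k, pd k (fun w => √(h w).det * raisedCurl h I k p w) z) * h z p j := by
  have hinf : (∞ : WithTop ℕ∞) ≠ 0 := by simp
  have hdet := ContDiffAt.matrix_det hh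
  have hd' : ∀ᶠ w in 𝓝 z, (h w).det ≠ 0 := hdet.continuousAt.eventually_ne hd.ne'
  have hh' := fun i j => (hh i j).differentiableAt hinf
  have hV := fun k p => (ContDiffAt.raisedCurl hh hd.ne' I k p).differentiableAt hinf
  have hchr : ∀ k j, ∀ᶠ w in 𝓝 z, christoffel h k I j w
      = ∑ p, raisedCurl h I k p w * h w p j := fun k j => by
    filter_upwards [hs, hd', hK] with w h1 h2 h3
    exact christoffel_of_killing h1 h2 h3 k j
  have t1 : ∀ k, pd k (christoffel h k I j) z = ∑ p, (pd k (raisedCurl h I k p) z * h z p j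
      + raisedCurl h I k p z * pd k (fun w => h w p j) z) := fun k => by
    rw [Filter.EventuallyEq.pd_eq (hchr k j) k,
      pd_sum (f := fun p w => raisedCurl h I k p w * h w p j) k
        fun p _ => (hV k p).mul (hh' p j)]
    exact Finset.sum_congr rfl fun p _ => pd_mul k (hV k p) (hh' p j)
  -- A Killing field is divergence free: the trace `V^{kp} h_{pk}` pairs an antisymmetric with a
  -- symmetric matrix.
  have t2 : ∑ k, pd j (christoffel h k I k) z = 0 := by
    rw [← pd_sum j fun k _ => (ContDiffAt.christoffel hh hd.ne' k I k).differentiableAt hinf]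
    have : (fun w => ∑ k, christoffel h k I k w) =ᶠ[𝓝 z] fun _ => 0 := by
      filter_upwards [hs, Filter.eventually_all.2 fun k => hchr k k] with w h1 h2
      simp only [h2]
      exact sum_mul_eq_zero_of_antisymm (fun a b => raisedCurl_antisymm h I a b w)
        fun a b => h1.apply _ _
    rw [this.pd_eq, pd_const]
  -- Lowering an index leaves `V^{lp} Γ_{p,jl}`. Only the part of `Γ_{p,jl}` antisymmetric in `l, p`
  -- contributes, and this cancels the terms of `t1` in which `h` is differentiated.
  have t4 : ∑ k, ∑ l, christoffel h k j l z * christoffel h l I k z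
      = ∑ l, ∑ p, raisedCurl h I l p z * pd l (fun w => h w p j) z := by
    have e1 : ∑ k, ∑ l, christoffel h k j l z * christoffel h l I k z
        = ∑ l, ∑ p, raisedCurl h I l p z * ∑ k, h z p k * christoffel h k j l z := by
      rw [Finset.sum_comm]
      refine Finset.sum_congr rfl fun l _ => ?_
      simp only [fun k => (hchr l k).self_of_nhds, Finset.mul_sum]
      rw [Finset.sum_comm]
      exact Finset.sum_congr rfl fun p _ => Finset.sum_congr rfl fun k _ => by ring
    rw [e1, ← sub_eq_zero, ← Finset.sum_sub_distrib]
    simp only [← Finset.sum_sub_distrib, sum_mul_christoffel hd.ne', ← mul_sub]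
    refine sum_mul_eq_zero_of_antisymm (fun a b => raisedCurl_antisymm h I a b z) fun a b => ?_
    rw [pd_symm hs j a b, pd_symm hs a j b, pd_symm hs b j a]; ring
  have t3 : ∑ k, ∑ l, christoffel h k k l z * christoffel h l I j z
      = ∑ l, (∑ k, christoffel h k k l z) * ∑ p, raisedCurl h I l p z * h z p j := by
    rw [Finset.sum_comm]
    refine Finset.sum_congr rfl fun l _ => ?_
    rw [Finset.sum_mul, (hchr l j).self_of_nhds]
  -- The weight `√det h` produces the trace `Γ^q_{qk}`, that is, the terms of `t3`.
  have r1 : ∀ k p, pd k (fun w => √(h w).det * raisedCurl h I k p w) z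
      = √(h z).det * ((∑ q, christoffel h q q k z) * raisedCurl h I k p z
        + pd k (raisedCurl h I k p) z) := fun k p => by
    have hdd := hdet.differentiableAt hinf
    rw [pd_mul k (hdd.sqrt hd.ne') (hV k p), pd_sqrt_det k hh' hdd hd,
      sum_christoffel_contract hs]
    ring
  -- The traces are made opaque so that distributing the sums below does not unfold them.
  obtain ⟨c, hc⟩ : ∃ c : κ → ℝ, ∀ l, ∑ q, christoffel h q q l z = c l := ⟨_, fun _ => rfl⟩
  rw [ricci, t2, t3, t4]
  simp only [t1, r1, hc, Finset.sum_mul]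
  rw [Finset.sum_comm (f := fun p k => √(h z).det * _ * h z p j), sub_zero, mul_sub, mul_add]
  simp only [Finset.mul_sum]
  simp only [← Finset.sum_add_distrib, ← Finset.sum_sub_distrib]
  refine Finset.sum_congr rfl fun k _ => Finset.sum_congr rfl fun p _ => ?_
  ring

end Killing

/-! ### Locality and translation invariance -/

section Congr

variable {κ : Type*} [Fintype κ] [DecidableEq κ] {h h' : (κ → ℝ) → Matrix κ κ ℝ} {z : κ → ℝ}

lemma Filter.EventuallyEq.christoffel (H : h =ᶠ[𝓝 z] h') (k i j : κ) :
    christoffel h k i j =ᶠ[𝓝 z] christoffel h' k i j := by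
  filter_upwards [H.eventuallyEq_nhds] with w hw
  have : ∀ a b, (fun w => h w a b) =ᶠ[𝓝 w] fun w => h' w a b := fun a b =>
    hw.fun_comp (fun m => m a b)
  simp only [_root_.christoffel, hw.self_of_nhds, fun k a b => (this a b).pd_eq k]

lemma Filter.EventuallyEq.ricci_eq (H : h =ᶠ[𝓝 z] h') (i j : κ) :
    ricci h i j z = ricci h' i j z := by
  simp only [ricci, fun k i j => (H.christoffel k i j).self_of_nhds,
    fun k i j l => (H.christoffel k i j).pd_eq l]

lemma pd_add_right {f : (κ → ℝ) → ℝ} {v : κ → ℝ} (hf : ∀ w, f (w + v) = f w) (k : κ) (w : κ → ℝ) :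
    pd k f (w + v) = pd k f w := by
  have : (fun x => f (x + v)) = f := funext hf
  conv_rhs => rw [← this]
  simp only [pd]
  rw [fderiv_comp_add_right]

lemma raisedCurl_add {v : κ → ℝ} (hf : ∀ w, h (w + v) = h w) (I k p : κ) (w : κ → ℝ) :
    raisedCurl h I k p (w + v) = raisedCurl h I k p w := by
  simp only [raisedCurl, halfCurl, hf,
    fun k a b => pd_add_right (f := fun w => h w a b) (fun w => by rw [hf w]) k w]

/-- No differentiability is needed, since `fderiv` is `0` by default where it does not exist. This
disposes of the vertical terms of the divergence. -/
lemma pd_eq_zero_of_invariant {f : (κ → ℝ) → ℝ} {k : κ}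
    (hf : ∀ t : ℝ, f (z + t • Pi.single k 1) = f z) : pd k f z = 0 := by
  by_cases hd : DifferentiableAt ℝ f z
  · rw [pd, ← hd.lineDeriv_eq_fderiv, lineDeriv]
    simp [hf]
  · simp [pd, fderiv_zero_of_not_differentiableAt hd]

end Congr

/-! ### The Kaluza-Klein form of an invariant metric -/

section KaluzaKlein

variable {μ ν : Type*} [Fintype μ] [DecidableEq μ] [Fintype ν] [DecidableEq ν]

/-- The projection to the base coordinates. -/
def baseCoord (μ ν : Type*) : (μ ⊕ ν → ℝ) →L[ℝ] (μ → ℝ) :=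
  ContinuousLinearMap.pi fun α => ContinuousLinearMap.proj (Sum.inl α)

lemma baseCoord_single_inl (α : μ) :
    baseCoord μ ν (Pi.single (Sum.inl α) 1) = Pi.single α 1 := by
  ext β; simp [baseCoord, Pi.single_apply]

lemma baseCoord_single_inr (I : ν) : baseCoord μ ν (Pi.single (Sum.inr I) 1) = 0 := by
  ext β; simp [baseCoord]

lemma pd_inl_comp_baseCoord {f : (μ → ℝ) → ℝ} {z : μ ⊕ ν → ℝ}
    (hf : DifferentiableAt ℝ f (baseCoord μ ν z)) (α : μ) :
    pd (Sum.inl α) (fun w => f (baseCoord μ ν w)) z = pd α f (baseCoord μ ν z) := by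
  have := (hf.hasFDerivAt.comp z (baseCoord μ ν).hasFDerivAt).fderiv
  simp only [pd]
  rw [show (fun w => f (baseCoord μ ν w)) = f ∘ baseCoord μ ν from rfl, this,
    ContinuousLinearMap.comp_apply, baseCoord_single_inl]

lemma pd_inr_comp_baseCoord {f : (μ → ℝ) → ℝ} {z : μ ⊕ ν → ℝ}
    (hf : DifferentiableAt ℝ f (baseCoord μ ν z)) (I : ν) :
    pd (Sum.inr I) (fun w => f (baseCoord μ ν w)) z = 0 := by
  have := (hf.hasFDerivAt.comp z (baseCoord μ ν).hasFDerivAt).fderiv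
  simp only [pd]
  rw [show (fun w => f (baseCoord μ ν w)) = f ∘ baseCoord μ ν from rfl, this,
    ContinuousLinearMap.comp_apply, baseCoord_single_inr, map_zero]

/-- The matrix of `G_{IJ} (dx^I + A^I) (dx^J + A^J) + g_{αβ} db^α db^β`. -/
def kkMatrix (g : Matrix μ μ ℝ) (A : Matrix ν μ ℝ) (G : Matrix ν ν ℝ) :
    Matrix (μ ⊕ ν) (μ ⊕ ν) ℝ :=
  Matrix.fromBlocks (g + A.transpose * G * A) (A.transpose * G) (G * A) G

/-- The components of the horizontal lift `∂_α - A^J_α ∂_J`. -/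
def horizontalLift (A : Matrix ν μ ℝ) (α : μ) : μ ⊕ ν → ℝ :=
  Sum.elim (Pi.single α 1) (fun J => -A J α)

/-- Completing the square is a congruence with a unipotent matrix, so the determinant is that of the
block diagonal matrix of `g` and `G`. -/
lemma det_kkMatrix (g : Matrix μ μ ℝ) (A : Matrix ν μ ℝ) (G : Matrix ν ν ℝ) :
    (kkMatrix g A G).det = G.det * g.det := by
  have : kkMatrix g A G = Matrix.fromBlocks 1 A.transpose 0 1 * Matrix.fromBlocks g 0 0 G *
      Matrix.fromBlocks 1 0 A 1 := by
    simp [kkMatrix, Matrix.fromBlocks_multiply]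
  rw [this, Matrix.det_mul, Matrix.det_mul]
  simp [mul_comm]

lemma isSymm_kkMatrix {g : Matrix μ μ ℝ} {A : Matrix ν μ ℝ} {G : Matrix ν ν ℝ} (hg : g.IsSymm)
    (hG : G.IsSymm) : (kkMatrix g A G).IsSymm := by
  refine Matrix.IsSymm.fromBlocks ?_ ?_ hG <;>
  simp [Matrix.IsSymm, Matrix.transpose_mul, hg.eq, hG.eq, Matrix.mul_assoc]

lemma sum_horizontalLift_mul (A : Matrix ν μ ℝ) (α : μ) (f : μ ⊕ ν → ℝ) :
    ∑ a, horizontalLift A α a * f a = f (Sum.inl α) - ∑ J, A J α * f (Sum.inr J) := by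
  simp [Fintype.sum_sum_type, horizontalLift, Pi.single_apply, sub_eq_add_neg]

lemma sum_sum_mul_sum_sum {κ : Type*} [Fintype κ] (u v : μ → ℝ) (X : μ → κ → ℝ) (c : κ → κ → ℝ) :
    ∑ a, ∑ b, (∑ δ, u δ * X δ a) * (∑ ε, v ε * X ε b) * c a b
      = ∑ δ, ∑ ε, u δ * v ε * ∑ a, ∑ b, X δ a * X ε b * c a b := by
  have e : ∑ x : κ × κ, ∑ y : μ × μ, u y.1 * v y.2 * (X y.1 x.1 * X y.2 x.2 * c x.1 x.2)
      = ∑ y : μ × μ, ∑ x : κ × κ, u y.1 * v y.2 * (X y.1 x.1 * X y.2 x.2 * c x.1 x.2) :=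
    Finset.sum_comm
  simp only [Fintype.sum_prod_type] at e
  simp only [Finset.mul_sum, ← e, Finset.sum_mul]
  refine Finset.sum_congr rfl fun a _ => Finset.sum_congr rfl fun b _ => ?_
  rw [Finset.sum_comm]
  exact Finset.sum_congr rfl fun δ _ => Finset.sum_congr rfl fun ε _ => by ring

/-- The horizontal lifts are orthogonal to the fibers, and their inner products are given by `g`. -/
lemma sum_kkMatrix_mul_horizontalLift (g : Matrix μ μ ℝ) (A : Matrix ν μ ℝ) (G : Matrix ν ν ℝ)
    (α : μ) (p : μ ⊕ ν) : ∑ j, kkMatrix g A G p j * horizontalLift A α j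
      = Sum.elim (fun β => g β α) 0 p := by
  rcases p with β | I
  · simp [Fintype.sum_sum_type, horizontalLift, kkMatrix, Pi.single_apply, Matrix.mul_apply]
  · simp [Fintype.sum_sum_type, horizontalLift, kkMatrix, Pi.single_apply, Matrix.mul_apply]

/-- The gradient of a base coordinate is horizontal: the vector `g^{γδ} X_δ` is mapped by the metric
to the covector `db^γ`, which determines that row of the inverse. -/
lemma inv_kkMatrix_inl {g : Matrix μ μ ℝ} {A : Matrix ν μ ℝ} {G : Matrix ν ν ℝ} (hg : g.IsSymm)
    (hG : G.IsSymm) (hgd : g.det ≠ 0) (hGd : G.det ≠ 0) (γ : μ) (a : μ ⊕ ν) :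
    (kkMatrix g A G)⁻¹ (Sum.inl γ) a = ∑ δ, g⁻¹ γ δ * horizontalLift A δ a := by
  have hd : IsUnit (kkMatrix g A G).det := by
    rw [det_kkMatrix]; exact (mul_ne_zero hGd hgd).isUnit
  have h1 : ∀ p, ∑ j, kkMatrix g A G p j * (∑ δ, g⁻¹ γ δ * horizontalLift A δ j)
      = if p = Sum.inl γ then 1 else 0 := fun p => by
    have : ∑ j, kkMatrix g A G p j * (∑ δ, g⁻¹ γ δ * horizontalLift A δ j)
        = ∑ δ, g⁻¹ γ δ * ∑ j, kkMatrix g A G p j * horizontalLift A δ j := by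
      simp only [Finset.mul_sum]
      rw [Finset.sum_comm]
      exact Finset.sum_congr rfl fun _ _ => Finset.sum_congr rfl fun _ _ => by ring
    rw [this]
    simp only [sum_kkMatrix_mul_horizontalLift]
    rcases p with β | I
    · have := congrFun (congrFun (Matrix.nonsing_inv_mul g hgd.isUnit) γ) β
      rw [Matrix.mul_apply, Matrix.one_apply] at this
      simpa [hg.apply, eq_comm] using this
    · simp
  have h2 : (kkMatrix g A G).mulVec (fun j => ∑ δ, g⁻¹ γ δ * horizontalLift A δ j)
      = Pi.single (Sum.inl γ) 1 := by
    ext p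
    rw [Pi.single_apply, ← h1 p]; rfl
  have h3 := congrArg (kkMatrix g A G)⁻¹.mulVec h2
  simp only [Matrix.mulVec_mulVec, Matrix.nonsing_inv_mul _ hd, Matrix.one_mulVec] at h3
  have h4 := congrFun h3 a
  rw [h4, Matrix.mulVec_single_one, Matrix.col_apply, (isSymm_kkMatrix hg hG).inv.apply]

variable {g : (μ → ℝ) → Matrix μ μ ℝ} {A : (μ → ℝ) → Matrix ν μ ℝ} {G : (μ → ℝ) → Matrix ν ν ℝ}

/-- The metric `G_{IJ} (dx^I + A^I) (dx^J + A^J) + g_{αβ} db^α db^β`, with coefficients depending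
only on the base coordinates. -/
def kkMetric (g : (μ → ℝ) → Matrix μ μ ℝ) (A : (μ → ℝ) → Matrix ν μ ℝ)
    (G : (μ → ℝ) → Matrix ν ν ℝ) (z : μ ⊕ ν → ℝ) : Matrix (μ ⊕ ν) (μ ⊕ ν) ℝ :=
  kkMatrix (g (baseCoord μ ν z)) (A (baseCoord μ ν z)) (G (baseCoord μ ν z))

lemma kkMetric_add_vertical (g : (μ → ℝ) → Matrix μ μ ℝ) (A : (μ → ℝ) → Matrix ν μ ℝ)
    (G : (μ → ℝ) → Matrix ν ν ℝ) {v : μ ⊕ ν → ℝ} (hv : baseCoord μ ν v = 0) (w : μ ⊕ ν → ℝ) :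
    kkMetric g A G (w + v) = kkMetric g A G w := by
  simp [kkMetric, hv]

/-- The curvature `∂_α A^I_β - ∂_β A^I_α`. -/
noncomputable def curvature (A : (μ → ℝ) → Matrix ν μ ℝ) (I : ν) (α β : μ) (y : μ → ℝ) : ℝ :=
  pd α (fun w => A w I β) y - pd β (fun w => A w I α) y

lemma contDiffAt_kkMatrix {y : μ → ℝ} (hg : ∀ α β, ContDiffAt ℝ ∞ (fun w => g w α β) y)
    (hA : ∀ I β, ContDiffAt ℝ ∞ (fun w => A w I β) y)
    (hG : ∀ I J, ContDiffAt ℝ ∞ (fun w => G w I J) y) (i j : μ ⊕ ν) :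
    ContDiffAt ℝ ∞ (fun w => kkMatrix (g w) (A w) (G w) i j) y := by
  rcases i with α | I <;> rcases j with β | J <;>
  simp only [kkMatrix, Matrix.fromBlocks_apply₁₁, Matrix.fromBlocks_apply₁₂,
    Matrix.fromBlocks_apply₂₁, Matrix.fromBlocks_apply₂₂, Matrix.add_apply, Matrix.mul_apply,
    Matrix.transpose_apply]
  · exact (hg _ _).add (ContDiffAt.sum fun _ _ => (ContDiffAt.sum fun _ _ =>
      (hA _ _).mul (hG _ _)).mul (hA _ _))
  · exact ContDiffAt.sum fun _ _ => (hA _ _).mul (hG _ _)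
  · exact ContDiffAt.sum fun _ _ => (hG _ _).mul (hA _ _)
  · exact hG _ _

/-- With `ξ = G_{IJ} (dx^J + A^J)` one has `dξ = dG_{IJ} ∧ (dx^J + A^J) + G_{IJ} F^J`, and the first
term vanishes on horizontal vectors. -/
lemma sum_horizontalLift_mul_halfCurl {z : μ ⊕ ν → ℝ}
    (hg : ∀ α β, ContDiffAt ℝ ∞ (fun w => g w α β) (baseCoord μ ν z))
    (hA : ∀ I β, ContDiffAt ℝ ∞ (fun w => A w I β) (baseCoord μ ν z))
    (hG : ∀ I J, ContDiffAt ℝ ∞ (fun w => G w I J) (baseCoord μ ν z)) (I : ν) (δ ε : μ) :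
    ∑ a, ∑ b, horizontalLift (A (baseCoord μ ν z)) δ a * horizontalLift (A (baseCoord μ ν z)) ε b *
      halfCurl (kkMetric g A G) (Sum.inr I) b a z
      = (1 / 2) * ∑ J, G (baseCoord μ ν z) I J * curvature A J ε δ (baseCoord μ ν z) := by
  have hinf : (∞ : WithTop ℕ∞) ≠ 0 := by simp
  have hk := contDiffAt_kkMatrix hg hA hG
  have p1 : ∀ i j α, pd (Sum.inl α) (fun w => kkMetric g A G w i j) z
      = pd α (fun y => kkMatrix (g y) (A y) (G y) i j) (baseCoord μ ν z) := fun i j α =>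
    pd_inl_comp_baseCoord (f := fun y => kkMatrix (g y) (A y) (G y) i j)
      ((hk i j).differentiableAt hinf) α
  have p2 : ∀ i j J, pd (Sum.inr J) (fun w => kkMetric g A G w i j) z = 0 := fun i j J =>
    pd_inr_comp_baseCoord (f := fun y => kkMatrix (g y) (A y) (G y) i j)
      ((hk i j).differentiableAt hinf) J
  have p3 : ∀ α β, pd α (fun y => kkMatrix (g y) (A y) (G y) (Sum.inr I) (Sum.inl β))
      (baseCoord μ ν z) = ∑ J, (pd α (fun y => G y I J) (baseCoord μ ν z) * A (baseCoord μ ν z) J β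
        + G (baseCoord μ ν z) I J * pd α (fun y => A y J β) (baseCoord μ ν z)) := fun α β => by
    simp only [kkMatrix, Matrix.fromBlocks_apply₂₁, Matrix.mul_apply]
    rw [pd_sum (f := fun J y => G y I J * A y J β) α fun J _ =>
      ((hG I J).differentiableAt hinf).mul ((hA J β).differentiableAt hinf)]
    exact Finset.sum_congr rfl fun J _ =>
      pd_mul α ((hG I J).differentiableAt hinf) ((hA J β).differentiableAt hinf)
  have p4 : ∀ α J, pd α (fun y => kkMatrix (g y) (A y) (G y) (Sum.inr I) (Sum.inr J))
      (baseCoord μ ν z) = pd α (fun y => G y I J) (baseCoord μ ν z) := fun α J => rfl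
  simp only [mul_assoc, ← Finset.mul_sum, sum_horizontalLift_mul, halfCurl, p1, p2, p3, p4,
    sub_zero, zero_sub, curvature]
  simp only [neg_zero, mul_zero, Finset.sum_const_zero, sub_zero, ← Finset.sum_sub_distrib,
    Finset.mul_sum]
  exact Finset.sum_congr rfl fun J _ => by ring

/-- By `inv_kkMatrix_inl`, raising an index to a base index amounts to evaluation on horizontal
lifts, where the curl is known. -/
lemma raisedCurl_kkMetric {z : μ ⊕ ν → ℝ}
    (hg : ∀ α β, ContDiffAt ℝ ∞ (fun w => g w α β) (baseCoord μ ν z))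
    (hA : ∀ I β, ContDiffAt ℝ ∞ (fun w => A w I β) (baseCoord μ ν z))
    (hG : ∀ I J, ContDiffAt ℝ ∞ (fun w => G w I J) (baseCoord μ ν z))
    (hgs : (g (baseCoord μ ν z)).IsSymm) (hGs : (G (baseCoord μ ν z)).IsSymm)
    (hgd : (g (baseCoord μ ν z)).det ≠ 0) (hGd : (G (baseCoord μ ν z)).det ≠ 0)
    (I : ν) (γ β : μ) :
    raisedCurl (kkMetric g A G) (Sum.inr I) (Sum.inl γ) (Sum.inl β) z
      = ∑ δ, ∑ ε, (g (baseCoord μ ν z))⁻¹ γ δ * (g (baseCoord μ ν z))⁻¹ β ε *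
        ((1 / 2) * ∑ J, G (baseCoord μ ν z) I J * curvature A J ε δ (baseCoord μ ν z)) := by
  simp only [← sum_horizontalLift_mul_halfCurl hg hA hG]
  rw [← sum_sum_mul_sum_sum]
  simp only [← inv_kkMatrix_inl hgs hGs hgd hGd]
  rfl

end KaluzaKlein

/-! ### The twist over a two-dimensional base -/

section Surface

variable {ν : Type*} [Fintype ν] [DecidableEq ν] {g : (Fin 2 → ℝ) → Matrix (Fin 2) (Fin 2) ℝ}
  {A : (Fin 2 → ℝ) → Matrix ν (Fin 2) ℝ} {G : (Fin 2 → ℝ) → Matrix ν ν ℝ}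

/-- The components `√(det G) G_{IJ} F^J / dvol` over a two-dimensional base. -/
noncomputable def kkTwist (g : (Fin 2 → ℝ) → Matrix (Fin 2) (Fin 2) ℝ)
    (A : (Fin 2 → ℝ) → Matrix ν (Fin 2) ℝ) (G : (Fin 2 → ℝ) → Matrix ν ν ℝ) (I : ν)
    (y : Fin 2 → ℝ) : ℝ :=
  √(G y).det * ∑ J, G y I J * (curvature A J 0 1 y / √(g y).det)

lemma contDiffAt_kkTwist {y : Fin 2 → ℝ} (hg : ∀ α β, ContDiffAt ℝ ∞ (fun w => g w α β) y)
    (hA : ∀ I β, ContDiffAt ℝ ∞ (fun w => A w I β) y)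
    (hG : ∀ I J, ContDiffAt ℝ ∞ (fun w => G w I J) y)
    (hgd : 0 < (g y).det) (hGd : 0 < (G y).det) (I : ν) : ContDiffAt ℝ ∞ (kkTwist g A G I) y :=
  ((ContDiffAt.matrix_det hG).sqrt hGd.ne').mul <| ContDiffAt.sum fun _ _ => (hG _ _).mul <|
    (((hA _ _).pd _).sub ((hA _ _).pd _)).div ((ContDiffAt.matrix_det hg).sqrt hgd.ne')
      (Real.sqrt_pos.2 hgd).ne'

/-- A two-form on the plane has one component, and raising its indices multiplies it by `det g⁻¹`.
One factor `√det g` is absorbed by `√det h`. The signs of the constant matrix come from the order of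
the indices in `halfCurl`. -/
lemma sqrt_det_mul_raisedCurl {z : Fin 2 ⊕ ν → ℝ}
    (hg : ∀ α β, ContDiffAt ℝ ∞ (fun w => g w α β) (baseCoord (Fin 2) ν z))
    (hA : ∀ I β, ContDiffAt ℝ ∞ (fun w => A w I β) (baseCoord (Fin 2) ν z))
    (hG : ∀ I J, ContDiffAt ℝ ∞ (fun w => G w I J) (baseCoord (Fin 2) ν z))
    (hgs : (g (baseCoord (Fin 2) ν z)).IsSymm) (hGs : (G (baseCoord (Fin 2) ν z)).IsSymm)
    (hgd : 0 < (g (baseCoord (Fin 2) ν z)).det) (hGd : 0 < (G (baseCoord (Fin 2) ν z)).det)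
    (I : ν) (γ β : Fin 2) :
    √(kkMetric g A G z).det * raisedCurl (kkMetric g A G) (Sum.inr I) (Sum.inl γ) (Sum.inl β) z
      = !![0, -(1 / 2); 1 / 2, 0] γ β * kkTwist g A G I (baseCoord (Fin 2) ν z) := by
  obtain ⟨f, hf⟩ : ∃ f, ∑ J, G (baseCoord (Fin 2) ν z) I J *
    curvature A J 0 1 (baseCoord (Fin 2) ν z) = f := ⟨_, rfl⟩
  have hfs : ∀ ε δ, ∑ J, G (baseCoord (Fin 2) ν z) I J * curvature A J ε δ (baseCoord (Fin 2) ν z)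
      = !![0, 1; -1, 0] ε δ * f := by
    intro ε δ
    fin_cases ε <;> fin_cases δ <;> simp [← hf, curvature, ← Finset.sum_neg_distrib, ← mul_neg]
  rw [raisedCurl_kkMetric hg hA hG hgs hGs hgd.ne' hGd.ne']
  simp only [hfs, kkTwist, kkMetric, det_kkMatrix, Real.sqrt_mul hGd.le, ← mul_div_assoc,
    ← Finset.sum_div]
  set g₀ := g (baseCoord (Fin 2) ν z)
  have hdet : g₀⁻¹ 0 0 * g₀⁻¹ 1 1 - g₀⁻¹ 0 1 * g₀⁻¹ 1 0 = g₀.det⁻¹ := by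
    rw [← Matrix.det_fin_two, Matrix.det_nonsing_inv, Ring.inverse_eq_inv']
  have hs : √g₀.det * g₀.det⁻¹ = (√g₀.det)⁻¹ := by
    have h1 : √g₀.det ≠ 0 := (Real.sqrt_pos.2 hgd).ne'
    nth_rewrite 2 [← Real.sq_sqrt hgd.le]
    field_simp
  rw [div_eq_mul_inv _ √g₀.det, ← hs, ← hdet]
  fin_cases γ <;> fin_cases β <;>
    simp [Fin.sum_univ_two, -mul_eq_zero, -mul_eq_mul_left_iff] <;> ring

/-- For a Kaluza-Klein metric over a surface, the mixed Ricci equation at a point says that the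
derivatives of the twist vanish there. -/
theorem mixedRicci_iff_pd_kkTwist {U : Set (Fin 2 → ℝ)} (hU : IsOpen U)
    (hg : ∀ y ∈ U, ∀ α β, ContDiffAt ℝ ∞ (fun w => g w α β) y)
    (hA : ∀ y ∈ U, ∀ I β, ContDiffAt ℝ ∞ (fun w => A w I β) y)
    (hG : ∀ y ∈ U, ∀ I J, ContDiffAt ℝ ∞ (fun w => G w I J) y)
    (hgs : ∀ y ∈ U, (g y).IsSymm) (hGs : ∀ y ∈ U, (G y).IsSymm)
    (hgd : ∀ y ∈ U, 0 < (g y).det) (hGd : ∀ y ∈ U, 0 < (G y).det)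
    {z : Fin 2 ⊕ ν → ℝ} (hz : baseCoord (Fin 2) ν z ∈ U) (I : ν) :
    (∀ α, ricci (kkMetric g A G) (Sum.inr I) (Sum.inl α) z
      - ∑ J, A (baseCoord (Fin 2) ν z) J α *
        ricci (kkMetric g A G) (Sum.inr I) (Sum.inr J) z = 0) ↔
    ∀ k, pd k (kkTwist g A G I) (baseCoord (Fin 2) ν z) = 0 := by
  have hinf : (∞ : WithTop ℕ∞) ≠ 0 := by simp
  have hev : ∀ᶠ w in 𝓝 z, baseCoord (Fin 2) ν w ∈ U :=
    (baseCoord (Fin 2) ν).continuous.continuousAt.eventually_mem (hU.mem_nhds hz)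
  have hk := fun y hy => contDiffAt_kkMatrix (hg y hy) (hA y hy) (hG y hy)
  have hh : ∀ i j, ContDiffAt ℝ ∞ (fun w => kkMetric g A G w i j) z := fun i j =>
    ContDiffAt.comp z (g := fun y => kkMatrix (g y) (A y) (G y) i j) (hk _ hz i j)
      (baseCoord (Fin 2) ν).contDiff.contDiffAt
  have hd : 0 < (kkMetric g A G z).det := by
    rw [kkMetric, det_kkMatrix]; exact mul_pos (hGd _ hz) (hgd _ hz)
  have hK : ∀ᶠ w in 𝓝 z, ∀ i j, pd (Sum.inr I) (fun w => kkMetric g A G w i j) w = 0 := by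
    filter_upwards [hev] with w hw i j
    exact pd_inr_comp_baseCoord (f := fun y => kkMatrix (g y) (A y) (G y) i j)
      ((hk _ hw i j).differentiableAt hinf) I
  have hs : ∀ᶠ w in 𝓝 z, (kkMetric g A G w).IsSymm := by
    filter_upwards [hev] with w hw using isSymm_kkMatrix (hgs _ hw) (hGs _ hw)
  have key := sqrt_det_mul_ricci_of_killing hh hs hd hK
  obtain ⟨D, hD⟩ : ∃ D : Fin 2 ⊕ ν → ℝ, ∀ p, ∑ k, pd k (fun w => √(kkMetric g A G w).det *
    raisedCurl (kkMetric g A G) (Sum.inr I) k p w) z = D p := ⟨_, fun _ => rfl⟩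
  have tw := (contDiffAt_kkTwist (hg _ hz) (hA _ hz) (hG _ hz) (hgd _ hz) (hGd _ hz) I
    ).differentiableAt hinf
  have hDβ : ∀ β, D (Sum.inl β) = ∑ γ, !![0, -(1 / 2); 1 / 2, 0] γ β *
      pd γ (kkTwist g A G I) (baseCoord (Fin 2) ν z) := by
    intro β
    rw [← hD, Fintype.sum_sum_type]
    have e : ∀ γ, (fun w => √(kkMetric g A G w).det *
        raisedCurl (kkMetric g A G) (Sum.inr I) (Sum.inl γ) (Sum.inl β) w) =ᶠ[𝓝 z]
        fun w => !![0, -(1 / 2); 1 / 2, 0] γ β * kkTwist g A G I (baseCoord (Fin 2) ν w) := fun γ => by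
      filter_upwards [hev] with w hw using sqrt_det_mul_raisedCurl (hg _ hw) (hA _ hw) (hG _ hw)
        (hgs _ hw) (hGs _ hw) (hgd _ hw) (hGd _ hw) I γ β
    -- The metric does not depend on the fiber coordinates, so the divergence runs over base
    -- directions only.
    have e' : ∀ J, pd (Sum.inr J) (fun w => √(kkMetric g A G w).det *
        raisedCurl (kkMetric g A G) (Sum.inr I) (Sum.inr J) (Sum.inl β) w) z = 0 := fun J =>
      pd_eq_zero_of_invariant fun t => by
        have hv : baseCoord (Fin 2) ν (t • Pi.single (Sum.inr J) 1) = 0 := by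
          rw [map_smul, baseCoord_single_inr, smul_zero]
        rw [raisedCurl_add (fun w => kkMetric_add_vertical g A G hv w),
          kkMetric_add_vertical g A G hv]
    simp only [e', Finset.sum_const_zero, add_zero]
    refine Finset.sum_congr rfl fun γ _ => ?_
    rw [(e γ).pd_eq, pd_const_mul (f := fun w => kkTwist g A G I (baseCoord (Fin 2) ν w)) _ _
      (tw.comp z (baseCoord (Fin 2) ν).differentiableAt), pd_inl_comp_baseCoord tw]
  -- Contraction of the divergence formula with the horizontal lift removes the vertical components
  -- `D (Sum.inr J)`.
  have hmix : ∀ α, √(kkMetric g A G z).det * (ricci (kkMetric g A G) (Sum.inr I) (Sum.inl α) z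
      - ∑ J, A (baseCoord (Fin 2) ν z) J α * ricci (kkMetric g A G) (Sum.inr I) (Sum.inr J) z)
      = ∑ β, D (Sum.inl β) * g (baseCoord (Fin 2) ν z) β α := fun α => by
    have e1 : √(kkMetric g A G z).det * (ricci (kkMetric g A G) (Sum.inr I) (Sum.inl α) z
        - ∑ J, A (baseCoord (Fin 2) ν z) J α * ricci (kkMetric g A G) (Sum.inr I) (Sum.inr J) z)
        = ∑ j, horizontalLift (A (baseCoord (Fin 2) ν z)) α j *
          (√(kkMetric g A G z).det * ricci (kkMetric g A G) (Sum.inr I) j z) := by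
      simp only [sum_horizontalLift_mul, mul_sub, Finset.mul_sum]
      congr 1
      exact Finset.sum_congr rfl fun J _ => by ring
    rw [e1]
    simp only [key, hD, Finset.mul_sum]
    rw [Finset.sum_comm]
    have e2 : ∀ p, ∑ j, horizontalLift (A (baseCoord (Fin 2) ν z)) α j *
        (D p * kkMetric g A G z p j) = D p * Sum.elim (fun β => g (baseCoord (Fin 2) ν z) β α) 0 p :=
      fun p => by
        rw [← sum_kkMatrix_mul_horizontalLift _ (A (baseCoord (Fin 2) ν z))
          (G (baseCoord (Fin 2) ν z)), Finset.mul_sum]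
        exact Finset.sum_congr rfl fun j _ => by rw [kkMetric]; ring
    simp [e2, Fintype.sum_sum_type]
  have hsd : √(kkMetric g A G z).det ≠ 0 := (Real.sqrt_pos.2 hd).ne'
  -- Up to the factor `1/2`, `D` is the gradient of the twist rotated by a right angle.
  have h0 : (∀ k, pd k (kkTwist g A G I) (baseCoord (Fin 2) ν z) = 0) ↔
      (fun β => D (Sum.inl β)) = 0 := by
    rw [funext_iff, Fin.forall_fin_two, Fin.forall_fin_two]
    simp only [hDβ, Fin.sum_univ_two]
    simp [and_comm]
  rw [h0]
  constructor
  · intro h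
    have h1 : Matrix.vecMul (fun β => D (Sum.inl β)) (g (baseCoord (Fin 2) ν z)) = 0 := by
      ext α
      have := hmix α
      rw [h α, mul_zero] at this
      exact this.symm
    have h2 := congrArg (Matrix.vecMul · (g (baseCoord (Fin 2) ν z))⁻¹) h1
    simpa [Matrix.vecMul_vecMul, Matrix.mul_nonsing_inv _ (hgd _ hz).ne'.isUnit] using h2
  · intro h α
    have h1 := hmix α
    simp only [fun β => congrFun h β, Pi.zero_apply, zero_mul, Finset.sum_const_zero] at h1
    exact (mul_eq_zero.1 h1).resolve_left hsd

end Surface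

/-! ### Metric components in a local parametrization -/

section CoordMetric

variable {m : ℕ} {M : Type*} [TopologicalSpace M] [ChartedSpace (EuclideanSpace ℝ (Fin m)) M]
  [IsManifold (𝓡 m) ∞ M] {κ : Type*} [Fintype κ] [DecidableEq κ] {gbar : SmoothMetric m M}
  {ψ : (κ → ℝ) → M} {z : κ → ℝ}

/-- The tangent map of `ψ` carries the constant section `∂_k` to a smooth field along `ψ`, and the
smooth bundle metric is applied to two such fields. -/
lemma contDiffAt_coordMetric {U : Set (κ → ℝ)} (hU : IsOpen U)
    (hψ : ContMDiffOn 𝓘(ℝ, κ → ℝ) (𝓡 m) ∞ ψ U) (hz : z ∈ U) (k l : κ) :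
    ContDiffAt ℝ ∞ (fun w => coordMetric gbar ψ w k l) z := by
  have hV : ∀ k : κ, ContMDiffAt 𝓘(ℝ, κ → ℝ) ((𝓡 m).tangent) ∞ (fun w =>
      Bundle.TotalSpace.mk' (EuclideanSpace ℝ (Fin m)) (E := fun p : M => TangentSpace (𝓡 m) p) (ψ w)
        (mfderiv 𝓘(ℝ, κ → ℝ) (𝓡 m) ψ w (Pi.single k 1 : κ → ℝ))) z := fun k => by
    have h1 := hψ.contMDiffOn_tangentMapWithin (m := ∞) (by simp) hU.uniqueMDiffOn
    have h2 : ContMDiff 𝓘(ℝ, κ → ℝ) (𝓘(ℝ, κ → ℝ).tangent) ∞ (fun w : κ → ℝ =>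
        (⟨w, (Pi.single k 1 : κ → ℝ)⟩ : TangentBundle 𝓘(ℝ, κ → ℝ) (κ → ℝ))) :=
      contMDiff_vectorSpace_iff_contDiff.2 contDiff_const
    have h3 := h1.comp (h2.contMDiffOn (s := U)) (fun w hw => hw)
    refine (h3.contMDiffAt (hU.mem_nhds hz)).congr_of_eventuallyEq ?_
    filter_upwards [hU.mem_nhds hz] with w hw
    simp only [Function.comp, tangentMapWithin]
    rw [mfderivWithin_of_isOpen hU hw]
  have hb : ContMDiffAt 𝓘(ℝ, κ → ℝ) (𝓡 m) ∞ ψ z := hψ.contMDiffAt (hU.mem_nhds hz)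
  have hg := gbar.contMDiff.contMDiffAt.comp z hb
  have := ContMDiffAt.clm_bundle_apply₂ (F₁ := EuclideanSpace ℝ (Fin m))
    (F₂ := EuclideanSpace ℝ (Fin m)) (F₃ := ℝ) (E₃ := Bundle.Trivial M ℝ) (b := ψ) hg (hV k) (hV l)
  simp only [Bundle.contMDiffAt_totalSpace] at this
  exact this.2.contDiffAt

lemma inner_mfderiv_eq_sum (a b : κ → ℝ) :
    gbar.inner (ψ z) (mfderiv 𝓘(ℝ, κ → ℝ) (𝓡 m) ψ z a) (mfderiv 𝓘(ℝ, κ → ℝ) (𝓡 m) ψ z b)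
      = ∑ k, ∑ l, a k * b l * coordMetric gbar ψ z k l := by
  have e : ∀ a : κ → ℝ, mfderiv 𝓘(ℝ, κ → ℝ) (𝓡 m) ψ z a
      = ∑ k, a k • mfderiv 𝓘(ℝ, κ → ℝ) (𝓡 m) ψ z (Pi.single k 1 : κ → ℝ) := fun a => by
    have ha : a = ∑ k, a k • (Pi.single k 1 : κ → ℝ) := by
      ext i; simp [Finset.sum_apply, Pi.single_apply]
    let D : (κ → ℝ) →L[ℝ] TangentSpace (𝓡 m) (ψ z) := mfderiv 𝓘(ℝ, κ → ℝ) (𝓡 m) ψ z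
    exact (congrArg D ha).trans ((map_sum D _ _).trans
      (Finset.sum_congr rfl fun k _ => map_smul D _ _))
  rw [e a, e b]
  simp only [map_sum, map_smul, sum_apply, smul_apply, coordMetric, Matrix.of_apply,
    smul_eq_mul, mul_assoc]
  simp only [Finset.mul_sum]
  rw [Finset.sum_comm]
  exact Finset.sum_congr rfl fun _ _ => Finset.sum_congr rfl fun _ _ => by ring

lemma posDef_coordMetric (hψ : Function.Injective (mfderiv 𝓘(ℝ, κ → ℝ) (𝓡 m) ψ z)) :
    (coordMetric gbar ψ z).PosDef := by
  refine Matrix.PosDef.of_dotProduct_mulVec_pos ?_ fun x hx => ?_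
  · ext i j
    simp [coordMetric, gbar.symm]
  · have h1 : mfderiv 𝓘(ℝ, κ → ℝ) (𝓡 m) ψ z x ≠ 0 := fun h =>
      hx (hψ (h.trans (map_zero _).symm))
    have h2 := gbar.pos _ _ h1
    rw [inner_mfderiv_eq_sum] at h2
    refine h2.trans_eq ?_
    simp only [dotProduct, Matrix.mulVec, Finset.mul_sum, star_trivial, mul_assoc]
    exact Finset.sum_congr rfl fun _ _ => Finset.sum_congr rfl fun _ _ => by ring

/-- The chain rule in a form that allows both a coordinate change `θ` and a local isometry `Φ`. It
serves for fiber translations as well as for changes of trivialization. -/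
lemma coordMetric_comp {κ' : Type*} [Fintype κ'] [DecidableEq κ'] {ψ' : (κ' → ℝ) → M} {z' : κ' → ℝ}
    {θ : (κ' → ℝ) → κ → ℝ} {θ' : (κ' → ℝ) →L[ℝ] (κ → ℝ)} {Φ : M → M}
    (h : ψ' =ᶠ[𝓝 z'] Φ ∘ ψ ∘ θ) (hθ : HasFDerivAt θ θ' z')
    (hψ : MDifferentiableAt 𝓘(ℝ, κ → ℝ) (𝓡 m) ψ (θ z'))
    (hΦ : MDifferentiableAt (𝓡 m) (𝓡 m) Φ (ψ (θ z')))
    (hΦ' : ∀ u v : TangentSpace (𝓡 m) (ψ (θ z')), gbar.inner (Φ (ψ (θ z')))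
      (mfderiv (𝓡 m) (𝓡 m) Φ (ψ (θ z')) u) (mfderiv (𝓡 m) (𝓡 m) Φ (ψ (θ z')) v)
      = gbar.inner (ψ (θ z')) u v) (k l : κ') :
    coordMetric gbar ψ' z' k l = ∑ a, ∑ b, θ' (Pi.single k 1) a * θ' (Pi.single l 1) b *
      coordMetric gbar ψ (θ z') a b := by
  have hd : HasMFDerivAt 𝓘(ℝ, κ' → ℝ) (𝓡 m) ψ' z'
      ((mfderiv (𝓡 m) (𝓡 m) Φ (ψ (θ z'))).comp
        ((mfderiv 𝓘(ℝ, κ → ℝ) (𝓡 m) ψ (θ z')).comp θ')) :=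
    (hΦ.hasMFDerivAt.comp z' (hψ.hasMFDerivAt.comp z' hθ.hasMFDerivAt)).congr_of_eventuallyEq h
  rw [← inner_mfderiv_eq_sum, ← hΦ', coordMetric, Matrix.of_apply, hd.mfderiv, h.self_of_nhds]
  rfl

end CoordMetric

/-! ### Inverse function theorem into a manifold -/

section LocalInverse

variable {E : Type*} [NormedAddCommGroup E] [NormedSpace ℝ E] [CompleteSpace E] {N : ℕ} {Q : Type*}
  [TopologicalSpace Q] [ChartedSpace (EuclideanSpace ℝ (Fin N)) Q] [IsManifold (𝓡 N) ∞ Q]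

/-- The inverse function theorem for a smooth map from a vector space to a manifold. -/
lemma ContMDiffAt.exists_local_inverse {f : E → Q} {a : E}
    (hf : ContMDiffAt 𝓘(ℝ, E) (𝓡 N) ∞ f a) (e : E ≃L[ℝ] EuclideanSpace ℝ (Fin N))
    (he : ∀ v : E, mfderiv 𝓘(ℝ, E) (𝓡 N) f a v = e v) :
    ∃ l : Q → E, ContMDiffAt (𝓡 N) 𝓘(ℝ, E) ∞ l (f a) ∧ l (f a) = a ∧
      (∀ᶠ v in 𝓝 a, l (f v) = v) ∧ ∀ᶠ x in 𝓝 (f a), f (l x) = x := by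
  have hinf : (∞ : WithTop ℕ∞) ≠ 0 := by simp
  set F : E → EuclideanSpace ℝ (Fin N) := extChartAt (𝓡 N) (f a) ∘ f with hF
  have hc : ContMDiffAt (𝓡 N) 𝓘(ℝ, EuclideanSpace ℝ (Fin N)) ∞ (extChartAt (𝓡 N) (f a)) (f a) :=
    contMDiffAt_extChartAt
  have hFs : ContDiffAt ℝ ∞ F a := (hc.comp a hf).contDiffAt
  have hFd : HasFDerivAt F (e : E →L[ℝ] EuclideanSpace ℝ (Fin N)) a := by
    have h1 := (hf.mdifferentiableAt hinf).hasMFDerivAt.2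
    have h2 : mfderiv 𝓘(ℝ, E) (𝓡 N) f a = (e : E →L[ℝ] EuclideanSpace ℝ (Fin N)) :=
      ContinuousLinearMap.ext he
    rw [h2] at h1
    simp only [writtenInExtChartAt, mfld_simps] at h1
    have h3 : HasFDerivWithinAt F (e : E →L[ℝ] EuclideanSpace ℝ (Fin N)) Set.univ a := h1
    exact hasFDerivWithinAt_univ.1 h3
  have hst := hFs.hasStrictFDerivAt' hFd hinf
  have hl := hFs.to_localInverse hFd hinf
  have hla : hFs.localInverse hFd hinf (F a) = a := hFs.localInverse_apply_image hFd hinf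
  have hls : ContMDiffAt (𝓡 N) 𝓘(ℝ, E) ∞
      (hFs.localInverse hFd hinf ∘ extChartAt (𝓡 N) (f a)) (f a) :=
    hl.contMDiffAt.comp (f a) hc
  refine ⟨hFs.localInverse hFd hinf ∘ extChartAt (𝓡 N) (f a), hls, hla,
    hst.eventually_left_inverse, ?_⟩
  have h1 : ∀ᶠ x in 𝓝 (f a), F (hFs.localInverse hFd hinf (extChartAt (𝓡 N) (f a) x))
      = extChartAt (𝓡 N) (f a) x := hc.continuousAt.eventually hst.eventually_right_inverse
  -- The right inverse identity is first known only after applying the chart. To cancel the chart,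
  -- `f (l x)` must lie in its source, which holds near `f a` by continuity.
  have h2 : ContinuousAt (f ∘ hFs.localInverse hFd hinf ∘ extChartAt (𝓡 N) (f a)) (f a) := by
    refine ContinuousAt.comp ?_ hls.continuousAt
    rw [Function.comp_apply]
    exact hla.symm ▸ hf.continuousAt
  have h3 : (extChartAt (𝓡 N) (f a)).source ∈
      𝓝 ((f ∘ hFs.localInverse hFd hinf ∘ extChartAt (𝓡 N) (f a)) (f a)) := by
    have : (f ∘ hFs.localInverse hFd hinf ∘ extChartAt (𝓡 N) (f a)) (f a) = f a :=
      congrArg f hla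
    rw [this]
    exact extChartAt_source_mem_nhds (f a)
  filter_upwards [h1, h2 h3, extChartAt_source_mem_nhds (I := 𝓡 N) (f a)] with x hx1 hx2 hx3
  exact (extChartAt (𝓡 N) (f a)).injOn hx2 hx3 hx1

end LocalInverse

/-! ### Rigidity of homomorphisms into a Lie group -/

section Homomorphisms

variable {N : ℕ} {E 𝒢 : Type*} [NormedAddCommGroup E] [NormedSpace ℝ E] [AddCommGroup 𝒢]
  [TopologicalSpace 𝒢] [ChartedSpace (EuclideanSpace ℝ (Fin N)) 𝒢] [LieAddGroup (𝓡 N) ∞ 𝒢]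

/-- Translations spread the vanishing of the differential from `0` to all points. In a chart, `r` is
then constant on a ball, and every vector is a natural multiple of one in the ball. -/
lemma AddMonoidHom.eq_zero_of_mfderiv_eq_zero (r : E →+ 𝒢) (hr : ContMDiff 𝓘(ℝ, E) (𝓡 N) ∞ r)
    (h0 : mfderiv 𝓘(ℝ, E) (𝓡 N) r 0 = 0) : r = 0 := by
  have hinf : (∞ : WithTop ℕ∞) ≠ 0 := by simp
  have hman : IsManifold (𝓡 N) ∞ 𝒢 := inferInstance
  have hd : ∀ v, HasMFDerivAt 𝓘(ℝ, E) (𝓡 N) r v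
      (0 : TangentSpace 𝓘(ℝ, E) v →L[ℝ] TangentSpace (𝓡 N) (r v)) := by
    intro v
    -- Since `r w = r v + r (w - v)`, the differential at `v` factors through the one at `0`.
    have e : (r : E → 𝒢) = (fun x : 𝒢 => r v + x) ∘ r ∘ (fun w : E => w - v) := by
      ext w; simp
    have h1 : HasMFDerivAt 𝓘(ℝ, E) (𝓡 N) r (v - v)
        (0 : TangentSpace 𝓘(ℝ, E) (v - v) →L[ℝ] TangentSpace (𝓡 N) (r (v - v))) := by
      rw [sub_self, ← h0]
      exact (hr.mdifferentiableAt hinf).hasMFDerivAt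
    have h2 : MDifferentiableAt 𝓘(ℝ, E) 𝓘(ℝ, E) (fun w : E => w - v) v :=
      (differentiableAt_id.sub_const v).mdifferentiableAt
    have h3 : ContMDiff (𝓡 N) (𝓡 N) ∞ (fun x : 𝒢 => r v + x) := contMDiff_add_left
    have h4 := (h3.mdifferentiableAt (x := r (v - v)) hinf).hasMFDerivAt.comp v
      (HasMFDerivAt.comp (f := fun w : E => w - v) v h1 h2.hasMFDerivAt)
    rw [ContinuousLinearMap.zero_comp, ContinuousLinearMap.comp_zero] at h4
    rw [← e] at h4
    exact h4
  have hsrc : (r : E → 𝒢) ⁻¹' (extChartAt (𝓡 N) (0 : 𝒢)).source ∈ 𝓝 (0 : E) :=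
    hr.continuous.continuousAt (by rw [map_zero]; exact extChartAt_source_mem_nhds (0 : 𝒢))
  obtain ⟨ε, hε, hball⟩ := Metric.mem_nhds_iff.1 hsrc
  have hzero : ∀ v ∈ Metric.ball (0 : E) ε, r v = 0 := by
    intro v hv
    have hF : ∀ w ∈ Metric.ball (0 : E) ε, HasFDerivAt (extChartAt (𝓡 N) (0 : 𝒢) ∘ r)
        (0 : E →L[ℝ] EuclideanSpace ℝ (Fin N)) w := fun w hw => by
      have h1 : MDifferentiableAt (𝓡 N) 𝓘(ℝ, EuclideanSpace ℝ (Fin N))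
          (extChartAt (𝓡 N) (0 : 𝒢)) (r w) :=
        (contMDiffAt_extChartAt' (n := ∞) (by
          have := hball hw
          rwa [Set.mem_preimage, extChartAt_source] at this)).mdifferentiableAt hinf
      have h2 := h1.hasMFDerivAt.comp w (hd w)
      rw [ContinuousLinearMap.comp_zero] at h2
      exact h2.hasFDerivAt
    have := (convex_ball (0 : E) ε).is_const_of_fderivWithin_eq_zero (𝕜 := ℝ)
      (f := extChartAt (𝓡 N) (0 : 𝒢) ∘ r)
      (fun w hw => (hF w hw).differentiableAt.differentiableWithinAt)
      (fun w hw => (hF w hw).hasFDerivWithinAt.fderivWithin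
        (Metric.isOpen_ball.uniqueDiffWithinAt hw)) hv (Metric.mem_ball_self hε)
    have := (extChartAt (𝓡 N) (0 : 𝒢)).injOn (hball hv) (hball (Metric.mem_ball_self hε)) this
    rwa [map_zero] at this
  ext v
  obtain ⟨k, hk⟩ := exists_nat_gt (‖v‖ / ε)
  have hk0 : (0 : ℝ) < k := (div_nonneg (norm_nonneg v) hε.le).trans_lt hk
  have hv : v = k • ((k : ℝ)⁻¹ • v) := by
    rw [← Nat.cast_smul_eq_nsmul ℝ, smul_smul, mul_inv_cancel₀ hk0.ne', one_smul]
  rw [hv, map_nsmul, hzero, smul_zero, AddMonoidHom.zero_apply]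
  rw [mem_ball_zero_iff, norm_smul, norm_inv, Real.norm_of_nonneg hk0.le, inv_mul_lt_iff₀ hk0]
  rwa [div_lt_iff₀ hε] at hk

lemma AddMonoidHom.eq_of_mfderiv_eq (p q : E →+ 𝒢) (hp : ContMDiff 𝓘(ℝ, E) (𝓡 N) ∞ p)
    (hq : ContMDiff 𝓘(ℝ, E) (𝓡 N) ∞ q)
    (h : ∀ v : E, (mfderiv 𝓘(ℝ, E) (𝓡 N) p 0 v : EuclideanSpace ℝ (Fin N))
      = mfderiv 𝓘(ℝ, E) (𝓡 N) q 0 v) : p = q := by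
  have hinf : (∞ : WithTop ℕ∞) ≠ 0 := by simp
  rw [← sub_eq_zero]
  refine (p - q).eq_zero_of_mfderiv_eq_zero (hp.sub hq) ?_
  have hs : ContMDiff ((𝓡 N).prod (𝓡 N)) (𝓡 N) ∞ (fun x : 𝒢 × 𝒢 => x.1 - x.2) :=
    contMDiff_fst.sub contMDiff_snd
  have hp0 := (hp.mdifferentiableAt (x := 0) hinf).hasMFDerivAt
  have hq0 := (hq.mdifferentiableAt (x := 0) hinf).hasMFDerivAt
  let L : 𝒢 × 𝒢 → (EuclideanSpace ℝ (Fin N) × EuclideanSpace ℝ (Fin N) →L[ℝ]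
    EuclideanSpace ℝ (Fin N)) := fun x =>
      mfderiv ((𝓡 N).prod (𝓡 N)) (𝓡 N) (fun x : 𝒢 × 𝒢 => x.1 - x.2) x
  let Dp : E →L[ℝ] EuclideanSpace ℝ (Fin N) := mfderiv 𝓘(ℝ, E) (𝓡 N) p 0
  let Dq : E →L[ℝ] EuclideanSpace ℝ (Fin N) := mfderiv 𝓘(ℝ, E) (𝓡 N) q 0
  have h1 := ((hs.mdifferentiableAt (x := (p 0, q 0)) hinf).hasMFDerivAt.comp 0
    (hp0.prodMk hq0)).mfderiv
  -- Comparison with the constant map `p - p` shows that the differential of subtraction kills the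
  -- diagonal, without computing it.
  have h2 := ((hs.mdifferentiableAt (x := (p 0, p 0)) hinf).hasMFDerivAt.comp 0
    (hp0.prodMk hp0)).mfderiv
  have e2 : (fun x : 𝒢 × 𝒢 => x.1 - x.2) ∘ (fun w : E => (p w, p w)) = fun _ => 0 := by
    ext w; simp
  rw [e2, mfderiv_const] at h2
  have hDq : Dq = Dp := ContinuousLinearMap.ext fun v => (h v).symm
  have hpt : (p 0, q 0) = (p 0, p 0) := by rw [map_zero, map_zero]
  have h1' : mfderiv 𝓘(ℝ, E) (𝓡 N) (p - q) 0 = (L (p 0, q 0)).comp (Dp.prod Dq) := h1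
  have h2' : 0 = (L (p 0, p 0)).comp (Dp.prod Dp) := h2
  rw [hpt, hDq, ← h2'] at h1'
  exact h1'

end Homomorphisms

lemma mfderiv_injective_of_left_inverse {E : Type*} [NormedAddCommGroup E] [NormedSpace ℝ E] {m : ℕ}
    {M : Type*} [TopologicalSpace M] [ChartedSpace (EuclideanSpace ℝ (Fin m)) M] {ψ : E → M}
    {R : M → E} {z : E} (hψ : MDifferentiableAt 𝓘(ℝ, E) (𝓡 m) ψ z)
    (hR : MDifferentiableAt (𝓡 m) 𝓘(ℝ, E) R (ψ z)) (h : ∀ᶠ w in 𝓝 z, R (ψ w) = w) :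
    Function.Injective (mfderiv 𝓘(ℝ, E) (𝓡 m) ψ z) := by
  have h1 := (hR.hasMFDerivAt.comp z hψ.hasMFDerivAt).congr_of_eventuallyEq
    (f₁ := id) (h.mono fun w hw => hw.symm)
  have h2 := hasMFDerivAt_unique h1 (hasMFDerivAt_id z)
  intro u v huv
  have h3 : ∀ w, (mfderiv (𝓡 m) 𝓘(ℝ, E) R (ψ z)) ((mfderiv 𝓘(ℝ, E) (𝓡 m) ψ z) w) = w :=
    fun w => congrArg (fun L => L w) h2
  rw [← h3 u, ← h3 v, huv]

/-! ### Adapted coordinates as smooth parametrizations -/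

namespace TwistedBundle

variable {ι : Type*} {n N : ℕ} {B 𝒢 M : Type*}
  [TopologicalSpace B] [ChartedSpace (EuclideanSpace ℝ (Fin n)) B] [IsManifold (𝓡 n) ∞ B]
  [AddCommGroup 𝒢] [TopologicalSpace 𝒢] [ChartedSpace (EuclideanSpace ℝ (Fin N)) 𝒢]
  [LieAddGroup (𝓡 N) ∞ 𝒢]
  [TopologicalSpace M] [ChartedSpace (EuclideanSpace ℝ (Fin (n + N))) M]
  [IsManifold (𝓡 (n + N)) ∞ M] {P : TwistedBundle ι n N B 𝒢 M}

lemma contMDiffAt_triv_symm (P : TwistedBundle ι n N B 𝒢 M) {i : ι} {b : B}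
    (hb : b ∈ (P.triv i).baseSet) (x : 𝒢) : ContMDiffAt ((𝓡 n).prod (𝓡 N)) (𝓡 (n + N)) ∞
      (P.triv i).toOpenPartialHomeomorph.symm (b, x) :=
  (P.contMDiffOn_triv_symm i).contMDiffAt ((P.triv i).open_target.mem_nhds
    ((P.triv i).mem_target.2 hb))

lemma contMDiffAt_triv (P : TwistedBundle ι n N B 𝒢 M) {i : ι} {p : M}
    (hp : p ∈ (P.triv i).source) : ContMDiffAt (𝓡 (n + N)) ((𝓡 n).prod (𝓡 N)) ∞ (P.triv i) p :=
  (P.contMDiffOn_triv i).contMDiffAt ((P.triv i).open_source.mem_nhds hp)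

lemma triv_apply_symm (P : TwistedBundle ι n N B 𝒢 M) {i : ι} {b : B}
    (hb : b ∈ (P.triv i).baseSet) (x : 𝒢) :
    P.triv i ((P.triv i).toOpenPartialHomeomorph.symm (b, x)) = (b, x) :=
  (P.triv i).apply_symm_apply' hb

lemma triv_symm_mem_source (P : TwistedBundle ι n N B 𝒢 M) {i : ι} {b : B}
    (hb : b ∈ (P.triv i).baseSet) (x : 𝒢) :
    (P.triv i).toOpenPartialHomeomorph.symm (b, x) ∈ (P.triv i).source :=
  (P.triv i).toOpenPartialHomeomorph.map_target ((P.triv i).mem_target.2 hb)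

lemma act_symm (P : TwistedBundle ι n N B 𝒢 M) {i : ι} {b : B}
    (hb : b ∈ (P.triv i).baseSet) (c x : 𝒢) :
    P.act i c ((P.triv i).toOpenPartialHomeomorph.symm (b, x))
      = (P.triv i).toOpenPartialHomeomorph.symm (b, x + c) := by
  rw [act, P.triv_apply_symm hb]

lemma mdifferentiableAt_act (P : TwistedBundle ι n N B 𝒢 M) (i : ι) (c : 𝒢) {p : M}
    (hp : p ∈ (P.triv i).source) :
    MDifferentiableAt (𝓡 (n + N)) (𝓡 (n + N)) (P.act i c) p := by
  have h1 := P.contMDiffAt_triv hp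
  have hb : (P.triv i p).1 ∈ (P.triv i).baseSet := by
    rw [(P.triv i).coe_fst hp]; exact (P.triv i).mem_source.1 hp
  have h2 : ContMDiffAt (𝓡 (n + N)) ((𝓡 n).prod (𝓡 N)) ∞
      (fun p => ((P.triv i p).1, (P.triv i p).2 + c)) p :=
    h1.fst.prodMk (h1.snd.add contMDiffAt_const)
  exact ((P.contMDiffAt_triv_symm hb _).comp p h2).mdifferentiableAt (by simp)

namespace AdaptedCoords

lemma isOpen_domain (C : P.AdaptedCoords) : IsOpen C.domain := by
  have h1 : IsOpen (C.chart.target ∩ C.chart.symm ⁻¹' (P.triv C.idx).baseSet) :=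
    C.chart.continuousOn_symm.isOpen_inter_preimage C.chart.open_target (P.triv C.idx).open_baseSet
  exact h1.preimage (PiLp.continuous_toLp 2 _)

lemma contMDiffAt_point (C : P.AdaptedCoords) {y : Fin n → ℝ} (hy : y ∈ C.domain) :
    ContMDiffAt 𝓘(ℝ, Fin n → ℝ) (𝓡 n) ∞ C.point y :=
  (contMDiffAt_symm_of_mem_maximalAtlas C.chart_mem hy.1).comp y
    (PiLp.contDiff_toLp (p := 2)).contMDiff.contMDiffAt

lemma chart_point (C : P.AdaptedCoords) {y : Fin n → ℝ} (hy : y ∈ C.domain) :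
    C.chart (C.point y) = WithLp.toLp 2 y :=
  C.chart.right_inv hy.1

lemma point_mem_source (C : P.AdaptedCoords) {y : Fin n → ℝ} (hy : y ∈ C.domain) :
    C.point y ∈ C.chart.source :=
  C.chart.map_target hy.1

/-- A local logarithm of `𝒢`, by the inverse function theorem. -/
lemma exists_lin_inverse (C : P.AdaptedCoords) :
    ∃ l : 𝒢 → EuclideanSpace ℝ (Fin N), ContMDiffAt (𝓡 N) (𝓡 N) ∞ l 0 ∧ l 0 = 0 ∧
      (∀ᶠ v in 𝓝 0, l (C.lin v) = v) ∧ ∀ᶠ x in 𝓝 0, C.lin (l x) = x := by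
  have := (C.contMDiff_lin.contMDiffAt (x := 0)).exists_local_inverse
    (ContinuousLinearEquiv.refl ℝ _) C.mfderiv_lin
  rwa [map_zero] at this

/-- The domain of the local parametrization `param`. -/
def paramDomain (C : P.AdaptedCoords) : Set (Fin n ⊕ Fin N → ℝ) :=
  baseCoord (Fin n) (Fin N) ⁻¹' C.domain

lemma isOpen_paramDomain (C : P.AdaptedCoords) : IsOpen C.paramDomain :=
  C.isOpen_domain.preimage (baseCoord (Fin n) (Fin N)).continuous

lemma contDiff_fiberCoord : ContDiff ℝ ∞ (fun z : Fin n ⊕ Fin N → ℝ =>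
    (WithLp.toLp 2 fun I => z (Sum.inr I) : EuclideanSpace ℝ (Fin N))) :=
  (PiLp.contDiff_toLp (p := 2)).comp (contDiff_pi.2 fun _ => contDiff_apply _ _ _)

lemma contMDiffOn_param (C : P.AdaptedCoords) :
    ContMDiffOn 𝓘(ℝ, Fin n ⊕ Fin N → ℝ) (𝓡 (n + N)) ∞ C.param C.paramDomain := by
  intro z hz
  refine ContMDiffAt.contMDiffWithinAt ?_
  have h1 : ContMDiffAt 𝓘(ℝ, Fin n ⊕ Fin N → ℝ) (𝓡 n) ∞
      (fun z => C.point (baseCoord (Fin n) (Fin N) z)) z :=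
    (C.contMDiffAt_point hz).comp z (baseCoord (Fin n) (Fin N)).contDiff.contMDiff.contMDiffAt
  have h2 : ContMDiffAt 𝓘(ℝ, Fin n ⊕ Fin N → ℝ) (𝓡 N) ∞
      (fun z => C.lin (WithLp.toLp 2 fun I => z (Sum.inr I))) z :=
    C.contMDiff_lin.contMDiffAt.comp z contDiff_fiberCoord.contMDiff.contMDiffAt
  exact (P.contMDiffAt_triv_symm hz.2 _).comp z (h1.prodMk h2)

lemma mfderiv_param_injective (C : P.AdaptedCoords) {z : Fin n ⊕ Fin N → ℝ}
    (hz : z ∈ C.paramDomain) :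
    Function.Injective (mfderiv 𝓘(ℝ, Fin n ⊕ Fin N → ℝ) (𝓡 (n + N)) C.param z) := by
  have hinf : (∞ : WithTop ℕ∞) ≠ 0 := by simp
  obtain ⟨l, hl, -, hl1, -⟩ := C.exists_lin_inverse
  set v : EuclideanSpace ℝ (Fin N) := WithLp.toLp 2 fun I => z (Sum.inr I) with hv
  -- A local left inverse of `param` near `z`. The logarithm `l` is only available near `0`, so the
  -- fiber is translated by `C.lin v` first and `v` is added back afterwards.
  let R : M → Fin n ⊕ Fin N → ℝ := fun p => Sum.elim
    (WithLp.ofLp (C.chart (P.triv C.idx p).1)) (WithLp.ofLp (l ((P.triv C.idx p).2 - C.lin v) + v))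
  have hz' : C.param z = (P.triv C.idx).toOpenPartialHomeomorph.symm
    (C.point (baseCoord (Fin n) (Fin N) z), C.lin v) := rfl
  have ht : P.triv C.idx (C.param z) = (C.point (baseCoord (Fin n) (Fin N) z), C.lin v) := by
    rw [hz', P.triv_apply_symm hz.2]
  have htd := P.contMDiffAt_triv (p := C.param z) (by rw [hz']; exact P.triv_symm_mem_source hz.2 _)
  have hR : ContMDiffAt (𝓡 (n + N)) 𝓘(ℝ, Fin n ⊕ Fin N → ℝ) ∞ R (C.param z) := by
    have h1 : ContMDiffAt (𝓡 (n + N)) (𝓡 n) ∞ (fun p => C.chart (P.triv C.idx p).1) (C.param z) :=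
      ContMDiffAt.comp (C.param z) (g := C.chart) (by
        rw [ht]; exact contMDiffAt_of_mem_maximalAtlas C.chart_mem (C.point_mem_source hz)) htd.fst
    have h2 : ContMDiffAt (𝓡 (n + N)) (𝓡 N) ∞
        (fun p => l ((P.triv C.idx p).2 - C.lin v) + v) (C.param z) :=
      (ContMDiffAt.comp (C.param z) (g := l) (f := fun p => (P.triv C.idx p).2 - C.lin v)
        (by rw [ht, sub_self]; exact hl) (htd.snd.sub contMDiffAt_const)).add contMDiffAt_const
    have h1' := (PiLp.contDiff_ofLp (p := 2)).contMDiff.contMDiffAt.comp (C.param z) h1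
    have h2' := (PiLp.contDiff_ofLp (p := 2)).contMDiff.contMDiffAt.comp (C.param z) h2
    rw [contMDiffAt_pi_space] at h1' h2' ⊢
    rintro (α | I)
    · exact h1' α
    · exact h2' I
  refine mfderiv_injective_of_left_inverse (R := R)
    ((C.contMDiffOn_param.contMDiffAt (C.isOpen_paramDomain.mem_nhds hz)).mdifferentiableAt hinf)
    (hR.mdifferentiableAt hinf) ?_
  have hcont : ContinuousAt (fun w : Fin n ⊕ Fin N → ℝ =>
      (WithLp.toLp 2 fun I => w (Sum.inr I) : EuclideanSpace ℝ (Fin N)) - v) z :=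
    contDiff_fiberCoord.continuous.continuousAt.sub continuousAt_const
  have hl2 : ∀ᶠ w : Fin n ⊕ Fin N → ℝ in 𝓝 z, l (C.lin ((WithLp.toLp 2 fun I => w (Sum.inr I)) - v))
      = (WithLp.toLp 2 fun I => w (Sum.inr I)) - v := by
    have ht0 := hcont.tendsto
    rw [show (WithLp.toLp 2 fun I => z (Sum.inr I) : EuclideanSpace ℝ (Fin N)) - v = 0 from
      sub_self v] at ht0
    exact ht0.eventually hl1
  filter_upwards [C.isOpen_paramDomain.mem_nhds hz, hl2] with w hw hw2
  have ht' : P.triv C.idx (C.param w) = (C.point (baseCoord (Fin n) (Fin N) w),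
      C.lin (WithLp.toLp 2 fun I => w (Sum.inr I))) := P.triv_apply_symm hw.2 _
  ext i
  simp only [R, ht', C.chart_point hw, ← map_sub, hw2, sub_add_cancel]
  rcases i with α | I <;> rfl

lemma mfderiv_param_bijective (C : P.AdaptedCoords) {z : Fin n ⊕ Fin N → ℝ}
    (hz : z ∈ C.paramDomain) :
    Function.Bijective (mfderiv 𝓘(ℝ, Fin n ⊕ Fin N → ℝ) (𝓡 (n + N)) C.param z) := by
  have h := C.mfderiv_param_injective hz
  let D : (Fin n ⊕ Fin N → ℝ) →ₗ[ℝ] EuclideanSpace ℝ (Fin (n + N)) :=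
    (mfderiv 𝓘(ℝ, Fin n ⊕ Fin N → ℝ) (𝓡 (n + N)) C.param z).toLinearMap
  have hD : Function.Surjective D :=
    (LinearMap.injective_iff_surjective_of_finrank_eq_finrank (f := D) (by simp)).1 h
  exact ⟨h, hD⟩

end AdaptedCoords

end TwistedBundle

/-! ### Completing the square in a positive definite block matrix -/

section Blocks

variable {μ ν : Type*} [Fintype μ] [DecidableEq μ] [Fintype ν] [DecidableEq ν]
  {m : Matrix (μ ⊕ ν) (μ ⊕ ν) ℝ}

lemma Matrix.PosDef.toBlocks₂₂ (hm : m.PosDef) : m.toBlocks₂₂.PosDef :=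
  hm.submatrix Sum.inr_injective

lemma Matrix.PosDef.isSymm {κ : Type*} {h : Matrix κ κ ℝ} (hh : h.PosDef) : h.IsSymm := by
  have := hh.isHermitian
  rwa [Matrix.IsHermitian, Matrix.conjTranspose_eq_transpose_of_trivial] at this

lemma kkMatrix_toBlocks (hm : m.PosDef) :
    kkMatrix (m.toBlocks₁₁ - (m.toBlocks₂₂⁻¹ * m.toBlocks₂₁).transpose * m.toBlocks₂₂ *
      (m.toBlocks₂₂⁻¹ * m.toBlocks₂₁)) (m.toBlocks₂₂⁻¹ * m.toBlocks₂₁) m.toBlocks₂₂ = m := by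
  have hG := hm.toBlocks₂₂
  have hu : IsUnit m.toBlocks₂₂.det := hG.det_pos.ne'.isUnit
  have h21 : m.toBlocks₂₁.transpose = m.toBlocks₁₂ := by
    ext i j
    exact hm.isSymm.apply _ _
  have e1 : m.toBlocks₂₂ * (m.toBlocks₂₂⁻¹ * m.toBlocks₂₁) = m.toBlocks₂₁ := by
    rw [← Matrix.mul_assoc, Matrix.mul_nonsing_inv _ hu, Matrix.one_mul]
  have e2 : (m.toBlocks₂₂⁻¹ * m.toBlocks₂₁).transpose * m.toBlocks₂₂ = m.toBlocks₁₂ := by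
    rw [Matrix.transpose_mul, h21, Matrix.transpose_nonsing_inv, hG.isSymm.eq, Matrix.mul_assoc,
      Matrix.nonsing_inv_mul _ hu, Matrix.mul_one]
  rw [kkMatrix, e1, e2, sub_add_cancel, Matrix.fromBlocks_toBlocks]

end Blocks

/-! ### Invariant metrics in adapted coordinates -/

namespace TwistedBundle

variable {ι : Type*} {n N : ℕ} {B 𝒢 M : Type*}
  [TopologicalSpace B] [ChartedSpace (EuclideanSpace ℝ (Fin n)) B] [IsManifold (𝓡 n) ∞ B]
  [AddCommGroup 𝒢] [TopologicalSpace 𝒢] [ChartedSpace (EuclideanSpace ℝ (Fin N)) 𝒢]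
  [LieAddGroup (𝓡 N) ∞ 𝒢]
  [TopologicalSpace M] [ChartedSpace (EuclideanSpace ℝ (Fin (n + N))) M]
  [IsManifold (𝓡 (n + N)) ∞ M] {P : TwistedBundle ι n N B 𝒢 M} {gbar : SmoothMetric (n + N) M}

namespace AdaptedCoords

lemma mdifferentiableAt_param (C : P.AdaptedCoords) {z : Fin n ⊕ Fin N → ℝ}
    (hz : z ∈ C.paramDomain) :
    MDifferentiableAt 𝓘(ℝ, Fin n ⊕ Fin N → ℝ) (𝓡 (n + N)) C.param z :=
  (C.contMDiffOn_param.contMDiffAt (C.isOpen_paramDomain.mem_nhds hz)).mdifferentiableAt (by simp)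

lemma param_mem_source (C : P.AdaptedCoords) {z : Fin n ⊕ Fin N → ℝ} (hz : z ∈ C.paramDomain) :
    C.param z ∈ (P.triv C.idx).source :=
  P.triv_symm_mem_source hz.2 _

/-- Moving along the fiber by `x` is the action of `C.lin x`, an isometry, combined with a
translation of the coordinates, whose derivative is the identity. -/
lemma coordMetric_param_eq_metric (C : P.AdaptedCoords) (hinv : P.IsInvariant gbar)
    {z : Fin n ⊕ Fin N → ℝ} (hz : z ∈ C.paramDomain) :
    coordMetric gbar C.param z = C.metric gbar (baseCoord (Fin n) (Fin N) z) := by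
  set x : Fin n ⊕ Fin N → ℝ := Sum.elim 0 (fun I => z (Sum.inr I)) with hx
  set c : 𝒢 := C.lin (WithLp.toLp 2 fun I => z (Sum.inr I)) with hc
  have hbx : ∀ w : Fin n ⊕ Fin N → ℝ, (fun α => (w - x) (Sum.inl α)) = baseCoord (Fin n) (Fin N) w :=
    fun w => by ext α; simp [hx, baseCoord]
  have hzx : z - x = Sum.elim (baseCoord (Fin n) (Fin N) z) 0 := by
    ext (α | I) <;> simp [hx, baseCoord]
  have hzx' : z - x ∈ C.paramDomain := by
    have : baseCoord (Fin n) (Fin N) (z - x) = baseCoord (Fin n) (Fin N) z := hbx z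
    rw [paramDomain, Set.mem_preimage, this]; exact hz
  have heq : C.param =ᶠ[𝓝 z] P.act C.idx c ∘ C.param ∘ fun w => w - x := by
    filter_upwards [C.isOpen_paramDomain.mem_nhds hz] with w hw
    have hw' : C.point (baseCoord (Fin n) (Fin N) w) ∈ (P.triv C.idx).baseSet := hw.2
    simp only [Function.comp, param, hbx]
    rw [P.act_symm hw', hc, ← map_add]
    have : (WithLp.toLp 2 fun I => (w - x) (Sum.inr I)) + (WithLp.toLp 2 fun I => z (Sum.inr I))
        = (WithLp.toLp 2 fun I => w (Sum.inr I) : EuclideanSpace ℝ (Fin N)) := by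
      ext I; simp [hx]
    rw [this]; rfl
  ext k l
  have hsrc := C.param_mem_source hzx'
  have := coordMetric_comp (gbar := gbar) (θ' := ContinuousLinearMap.id ℝ _) heq
    ((hasFDerivAt_id z).sub_const x) (C.mdifferentiableAt_param hzx')
    (P.mdifferentiableAt_act _ _ hsrc) (hinv C.idx c _ hsrc) k l
  rw [this, metric, ← hzx]
  simp [Pi.single_apply]

lemma posDef_metric (C : P.AdaptedCoords) (gbar : SmoothMetric (n + N) M) {y : Fin n → ℝ}
    (hy : y ∈ C.domain) : (C.metric gbar y).PosDef :=
  posDef_coordMetric (C.mfderiv_param_injective (z := Sum.elim y 0) hy)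

lemma contDiffAt_metric (C : P.AdaptedCoords) (gbar : SmoothMetric (n + N) M) {y : Fin n → ℝ} (hy : y ∈ C.domain)
    (i j : Fin n ⊕ Fin N) : ContDiffAt ℝ ∞ (fun y => C.metric gbar y i j) y := by
  have h1 := contDiffAt_coordMetric (gbar := gbar) C.isOpen_paramDomain C.contMDiffOn_param
    (z := Sum.elim y 0) hy i j
  refine ContDiffAt.comp y (f := fun y : Fin n → ℝ => (Sum.elim y 0 : Fin n ⊕ Fin N → ℝ)) h1 ?_
  refine contDiffAt_pi.2 ?_
  rintro (α | I)
  · exact contDiffAt_apply ℝ _ α y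
  · exact contDiffAt_const

lemma metric_eq_kkMatrix (C : P.AdaptedCoords) (gbar : SmoothMetric (n + N) M) {y : Fin n → ℝ}
    (hy : y ∈ C.domain) :
    C.metric gbar y = kkMatrix (C.g gbar y) (C.A gbar y) (C.G gbar y) :=
  (kkMatrix_toBlocks (C.posDef_metric gbar hy)).symm

lemma posDef_G (C : P.AdaptedCoords) (gbar : SmoothMetric (n + N) M) {y : Fin n → ℝ}
    (hy : y ∈ C.domain) : (C.G gbar y).PosDef :=
  (C.posDef_metric gbar hy).toBlocks₂₂

lemma isSymm_g (C : P.AdaptedCoords) (gbar : SmoothMetric (n + N) M) {y : Fin n → ℝ}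
    (hy : y ∈ C.domain) : (C.g gbar y).IsSymm := by
  have h1 : (C.metric gbar y).toBlocks₁₁.IsSymm := by
    ext i j
    exact (C.posDef_metric gbar hy).isSymm.apply _ _
  have h2 := (C.posDef_G gbar hy).isSymm
  rw [Matrix.IsSymm, g, Matrix.transpose_sub, h1.eq]
  simp [Matrix.transpose_mul, h2.eq, Matrix.mul_assoc]

lemma det_g_pos (C : P.AdaptedCoords) (gbar : SmoothMetric (n + N) M) {y : Fin n → ℝ}
    (hy : y ∈ C.domain) : 0 < (C.g gbar y).det := by
  have h := (C.posDef_metric gbar hy).det_pos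
  rw [C.metric_eq_kkMatrix gbar hy, det_kkMatrix] at h
  exact (mul_pos_iff_of_pos_left (C.posDef_G gbar hy).det_pos).1 h

lemma contDiffAt_G (C : P.AdaptedCoords) (gbar : SmoothMetric (n + N) M) {y : Fin n → ℝ} (hy : y ∈ C.domain) (I J : Fin N) :
    ContDiffAt ℝ ∞ (fun y => C.G gbar y I J) y :=
  C.contDiffAt_metric gbar hy _ _

lemma contDiffAt_A (C : P.AdaptedCoords) (gbar : SmoothMetric (n + N) M) {y : Fin n → ℝ} (hy : y ∈ C.domain) (I : Fin N)
    (α : Fin n) : ContDiffAt ℝ ∞ (fun y => C.A gbar y I α) y := by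
  simp only [A, Matrix.mul_apply]
  exact ContDiffAt.sum fun J _ => (ContDiffAt.matrix_inv_apply (C.contDiffAt_G gbar hy)
    (C.posDef_G gbar hy).det_pos.ne' _ _).mul (C.contDiffAt_metric gbar hy _ _)

lemma contDiffAt_g (C : P.AdaptedCoords) (gbar : SmoothMetric (n + N) M) {y : Fin n → ℝ} (hy : y ∈ C.domain)
    (α β : Fin n) : ContDiffAt ℝ ∞ (fun y => C.g gbar y α β) y := by
  simp only [g, Matrix.mul_apply, Matrix.sub_apply, Matrix.transpose_apply]
  exact (C.contDiffAt_metric gbar hy _ _).sub (ContDiffAt.sum fun J _ => (ContDiffAt.sum fun K _ =>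
    (C.contDiffAt_A gbar hy _ _).mul (C.contDiffAt_G gbar hy _ _)).mul (C.contDiffAt_A gbar hy _ _))

lemma coordMetric_param_eventuallyEq (C : P.AdaptedCoords) (hinv : P.IsInvariant gbar)
    {z : Fin n ⊕ Fin N → ℝ} (hz : z ∈ C.paramDomain) :
    coordMetric gbar C.param =ᶠ[𝓝 z] kkMetric (C.g gbar) (C.A gbar) (C.G gbar) := by
  filter_upwards [C.isOpen_paramDomain.mem_nhds hz] with w hw
  rw [C.coordMetric_param_eq_metric hinv hw, C.metric_eq_kkMatrix gbar hw, kkMetric]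

end AdaptedCoords

/-- In adapted coordinates `Ric` is `lam` times the metric, and `∂_I` is orthogonal to the
horizontal lifts. -/
theorem _root_.IsEinstein.mixedRicciEquation {lam : ℝ} (h : IsEinstein gbar lam)
    (hinv : P.IsInvariant gbar) : P.MixedRicciEquation gbar := by
  intro C y hy x I α
  have hR := fun k l => h (Fin n ⊕ Fin N) (by simp) C.paramDomain C.param C.isOpen_paramDomain
    C.contMDiffOn_param (fun z hz => C.mfderiv_param_bijective hz) (Sum.elim y x) hy k l
  have hy' : baseCoord (Fin n) (Fin N) (Sum.elim y x) = y := rfl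
  have hm := C.coordMetric_param_eq_metric hinv (z := Sum.elim y x) hy
  rw [hy', C.metric_eq_kkMatrix gbar hy] at hm
  have hh := sum_kkMatrix_mul_horizontalLift (C.g gbar y) (C.A gbar y) (C.G gbar y) α (Sum.inr I)
  have hs := sum_horizontalLift_mul (C.A gbar y) α
    (kkMatrix (C.g gbar y) (C.A gbar y) (C.G gbar y) (Sum.inr I))
  simp only [hR, hm]
  have e : ∑ J, C.A gbar y J α * (lam * kkMatrix (C.g gbar y) (C.A gbar y) (C.G gbar y) (Sum.inr I)
      (Sum.inr J)) = lam * ∑ J, C.A gbar y J α * kkMatrix (C.g gbar y) (C.A gbar y) (C.G gbar y)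
      (Sum.inr I) (Sum.inr J) := by
    rw [Finset.mul_sum]
    exact Finset.sum_congr rfl fun _ _ => by ring
  rw [e, ← mul_sub, ← hs]
  simp only [mul_comm (horizontalLift _ _ _), hh, Sum.elim_inr, Pi.zero_apply, mul_zero]

end TwistedBundle

/-! ### The mixed Ricci equation in terms of the twist -/

namespace TwistedBundle

variable {ι : Type*} {N : ℕ} {B 𝒢 M : Type*}
  [TopologicalSpace B] [ChartedSpace (EuclideanSpace ℝ (Fin 2)) B] [IsManifold (𝓡 2) ∞ B]
  [AddCommGroup 𝒢] [TopologicalSpace 𝒢] [ChartedSpace (EuclideanSpace ℝ (Fin N)) 𝒢]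
  [LieAddGroup (𝓡 N) ∞ 𝒢]
  [TopologicalSpace M] [ChartedSpace (EuclideanSpace ℝ (Fin (2 + N))) M]
  [IsManifold (𝓡 (2 + N)) ∞ M] {P : TwistedBundle ι 2 N B 𝒢 M} {gbar : SmoothMetric (2 + N) M}

lemma AdaptedCoords.twist_eq_kkTwist (C : P.AdaptedCoords) (gbar : SmoothMetric (2 + N) M)
    (I : Fin N) : C.twist gbar I = kkTwist (C.g gbar) (C.A gbar) (C.G gbar) I :=
  rfl

lemma AdaptedCoords.contDiffAt_twist (C : P.AdaptedCoords) (gbar : SmoothMetric (2 + N) M)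
    {y : Fin 2 → ℝ} (hy : y ∈ C.domain) (I : Fin N) : ContDiffAt ℝ ∞ (C.twist gbar I) y := by
  rw [C.twist_eq_kkTwist]
  exact contDiffAt_kkTwist (fun _ _ => C.contDiffAt_g gbar hy _ _) (fun _ _ => C.contDiffAt_A gbar hy _ _)
    (fun _ _ => C.contDiffAt_G gbar hy _ _) (C.det_g_pos gbar hy) (C.posDef_G gbar hy).det_pos I

/-- The mixed Ricci equation says that the derivatives of the twist vanish in all adapted
coordinates. -/
theorem mixedRicciEquation_iff_pd_twist (hinv : P.IsInvariant gbar) :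
    P.MixedRicciEquation gbar ↔
      ∀ C : P.AdaptedCoords, ∀ y ∈ C.domain, ∀ I k, pd k (C.twist gbar I) y = 0 := by
  refine forall_congr' fun C => forall₂_congr fun y hy => ?_
  have key := fun (x : Fin N → ℝ) (I : Fin N) => mixedRicci_iff_pd_kkTwist C.isOpen_domain
    (fun y hy => C.contDiffAt_g gbar hy) (fun y hy => C.contDiffAt_A gbar hy)
    (fun y hy => C.contDiffAt_G gbar hy) (fun y hy => C.isSymm_g gbar hy)
    (fun y hy => (C.posDef_G gbar hy).isSymm) (fun y hy => C.det_g_pos gbar hy)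
    (fun y hy => (C.posDef_G gbar hy).det_pos) (z := Sum.elim y x) hy I
  have hr := fun (x : Fin N → ℝ) => (C.coordMetric_param_eventuallyEq hinv
    (z := Sum.elim y x) hy).ricci_eq
  have hy' : ∀ x : Fin N → ℝ, baseCoord (Fin 2) (Fin N) (Sum.elim y x) = y := fun _ => rfl
  simp only [hr, C.twist_eq_kkTwist]
  simp only [hy'] at key
  constructor
  · intro h I
    -- The twist lives on the base, so one point of the fiber is enough.
    exact (key 0 I).1 (h 0 I)
  · intro h x I
    exact (key x I).2 (h I)

end TwistedBundle

/-! ### Transformation of the twist under coordinate changes -/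

section CoordinateChange

lemma pd_comm {κ : Type*} [Fintype κ] [DecidableEq κ] {f : (κ → ℝ) → ℝ} {z : κ → ℝ}
    (hf : ContDiffAt ℝ ∞ f z) (α β : κ) : pd α (pd β f) z = pd β (pd α f) z := by
  have hd : DifferentiableAt ℝ (fderiv ℝ f) z :=
    (hf.fderiv_right (m := ∞) (by simp)).differentiableAt (by simp)
  have e : ∀ α β, pd α (pd β f) z
      = fderiv ℝ (fderiv ℝ f) z (Pi.single α 1) (Pi.single β 1) := fun α β => by
    have := (hd.hasFDerivAt.clm_apply (hasFDerivAt_const (Pi.single β 1 : κ → ℝ) z)).fderiv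
    unfold pd
    rw [this]; simp
  rw [e, e]
  refine (hf.isSymmSndFDerivAt ?_).eq _ _
  simp only [minSmoothness_of_isRCLikeNormedField]
  exact WithTop.coe_le_coe.2 le_top

lemma pd_comp {κ κ' : Type*} [Fintype κ] [DecidableEq κ] [Fintype κ'] [DecidableEq κ']
    {f : (κ → ℝ) → ℝ} {φ : (κ' → ℝ) → κ → ℝ} {z : κ' → ℝ} (hf : DifferentiableAt ℝ f (φ z))
    (hφ : ∀ k, DifferentiableAt ℝ (fun w => φ w k) z) (α : κ') :
    pd α (fun w => f (φ w)) z = ∑ k, pd k f (φ z) * pd α (fun w => φ w k) z := by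
  have hφ' : HasFDerivAt φ (ContinuousLinearMap.pi fun k => fderiv ℝ (fun w => φ w k) z) z :=
    hasFDerivAt_pi.2 fun k => (hφ k).hasFDerivAt
  have h1 := (hf.hasFDerivAt.comp z hφ').fderiv
  rw [pd, show (fun w => f (φ w)) = f ∘ φ from rfl, h1, ContinuousLinearMap.comp_apply]
  have hv : ∀ v : κ → ℝ, fderiv ℝ f (φ z) v = ∑ k, pd k f (φ z) * v k := fun v => by
    have : v = ∑ k, v k • (Pi.single k 1 : κ → ℝ) := by
      ext i; simp [Finset.sum_apply, Pi.single_apply]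
    conv_lhs => rw [this]
    rw [map_sum]
    exact Finset.sum_congr rfl fun k _ => by rw [map_smul, smul_eq_mul, mul_comm]; rfl
  rw [hv]; rfl

/-- The Jacobian matrix of a map between coordinate spaces. -/
noncomputable def jacobian {κ κ' : Type*} [Fintype κ'] [DecidableEq κ'] (φ : (κ' → ℝ) → κ → ℝ)
    (y : κ' → ℝ) : Matrix κ κ' ℝ :=
  Matrix.of fun k α => pd α (fun w => φ w k) y

/-- Pullback commutes with the exterior derivative of one-forms on the plane. -/
lemma pd_pullback_sub_pd_pullback {a : (Fin 2 → ℝ) → Fin 2 → ℝ} {φ : (Fin 2 → ℝ) → Fin 2 → ℝ}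
    {s : (Fin 2 → ℝ) → ℝ} {y : Fin 2 → ℝ} (ha : ∀ γ, DifferentiableAt ℝ (fun w => a w γ) (φ y))
    (hφ : ∀ γ, ContDiffAt ℝ ∞ (fun w => φ w γ) y) (hs : ContDiffAt ℝ ∞ s y) :
    pd 0 (fun w => ∑ γ, a (φ w) γ * jacobian φ w γ 1 + pd 1 s w) y
      - pd 1 (fun w => ∑ γ, a (φ w) γ * jacobian φ w γ 0 + pd 0 s w) y
      = (jacobian φ y).det *
        (pd 0 (fun w => a w 1) (φ y) - pd 1 (fun w => a w 0) (φ y)) := by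
  have hinf : (∞ : WithTop ℕ∞) ≠ 0 := by simp
  have hφd := fun γ => (hφ γ).differentiableAt hinf
  have hφ2 := fun γ α => ((hφ γ).pd α).differentiableAt hinf
  have hφd' : DifferentiableAt ℝ φ y := differentiableAt_pi.2 hφd
  have hac : ∀ γ, DifferentiableAt ℝ (fun w => a (φ w) γ) y := fun γ =>
    DifferentiableAt.comp y (g := fun w => a w γ) (ha γ) hφd'
  have e : ∀ α β, pd α (fun w => ∑ γ, a (φ w) γ * jacobian φ w γ β + pd β s w) y
      = ∑ γ, ((∑ δ, pd δ (fun w => a w γ) (φ y) * pd α (fun w => φ w δ) y) *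
          pd β (fun w => φ w γ) y + a (φ y) γ * pd α (pd β fun w => φ w γ) y)
        + pd α (pd β s) y := fun α β => by
    simp only [jacobian, Matrix.of_apply]
    have hterm : ∀ γ, DifferentiableAt ℝ (fun w => a (φ w) γ * pd β (fun w => φ w γ) w) y :=
      fun γ => (hac γ).mul (hφ2 γ β)
    rw [pd_add α (DifferentiableAt.fun_sum fun γ _ => hterm γ) ((hs.pd β).differentiableAt hinf),
      pd_sum α fun γ _ => hterm γ]
    congr 1
    refine Finset.sum_congr rfl fun γ _ => ?_
    rw [pd_mul α (hac γ) (hφ2 γ β), pd_comp (f := fun w => a w γ) (ha γ) hφd]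
  -- The second derivatives of `φ` and `s` cancel by symmetry; the first order terms assemble to the
  -- Jacobian determinant.
  rw [e, e, pd_comm hs 0 1]
  simp only [Fin.sum_univ_two, pd_comm (hφ 0) 0 1, pd_comm (hφ 1) 0 1, Matrix.det_fin_two, jacobian,
    Matrix.of_apply]
  ring

variable {μ ν : Type*} [Fintype μ] [DecidableEq μ] [Fintype ν] [DecidableEq ν]

/-- The form `dx + A` pulls back to `L dx' + S + A Φ = L (dx' + L⁻¹ (A Φ + S))`, which again has
Kaluza-Klein shape. -/
lemma transpose_mul_kkMatrix_mul (g Φ : Matrix μ μ ℝ) (A S : Matrix ν μ ℝ) (G L : Matrix ν ν ℝ)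
    (hL : L.det ≠ 0) :
    (Matrix.fromBlocks Φ 0 S L).transpose * kkMatrix g A G * Matrix.fromBlocks Φ 0 S L
      = kkMatrix (Φ.transpose * g * Φ) (L⁻¹ * (A * Φ + S)) (L.transpose * G * L) := by
  have h1 : L * (L⁻¹ * (A * Φ + S)) = A * Φ + S := by
    rw [← Matrix.mul_assoc, Matrix.mul_nonsing_inv _ hL.isUnit, Matrix.one_mul]
  have h2 : (L⁻¹ * (A * Φ + S)).transpose * L.transpose = (A * Φ + S).transpose := by
    rw [← Matrix.transpose_mul, h1]
  have e1 : L.transpose * G * L * (L⁻¹ * (A * Φ + S)) = L.transpose * G * (A * Φ + S) := by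
    rw [Matrix.mul_assoc _ L, h1]
  have e2 : (L⁻¹ * (A * Φ + S)).transpose * (L.transpose * G * L)
      = (A * Φ + S).transpose * G * L := by
    rw [Matrix.mul_assoc L.transpose, ← Matrix.mul_assoc, h2, Matrix.mul_assoc]
  have e3 : (L⁻¹ * (A * Φ + S)).transpose * (L.transpose * G * L) * (L⁻¹ * (A * Φ + S))
      = (A * Φ + S).transpose * G * (A * Φ + S) := by
    rw [e2, Matrix.mul_assoc _ L, h1]
  rw [kkMatrix, kkMatrix, e3, e2, e1]
  simp only [Matrix.fromBlocks_transpose, Matrix.fromBlocks_multiply, Matrix.transpose_zero,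
    Matrix.zero_mul, Matrix.mul_zero, zero_add, add_zero, Matrix.transpose_add,
    Matrix.transpose_mul, Matrix.mul_add, Matrix.add_mul, Matrix.mul_assoc]
  congr 1
  abel

/-- Allows the transformation rules of `g`, `A` and `G` to be read off separately from that of the
whole metric. -/
lemma kkMatrix_injective {g g' : Matrix μ μ ℝ} {A A' : Matrix ν μ ℝ} {G G' : Matrix ν ν ℝ}
    (hG : G.det ≠ 0) (h : kkMatrix g A G = kkMatrix g' A' G') : g = g' ∧ A = A' ∧ G = G' := by
  obtain ⟨h1, -, h3, rfl⟩ := Matrix.fromBlocks_inj.1 h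
  have hA : A = A' := by
    have := congrArg (G⁻¹ * ·) h3
    simpa [← Matrix.mul_assoc, Matrix.nonsing_inv_mul _ hG.isUnit] using this
  subst hA
  exact ⟨add_right_cancel h1, rfl, rfl⟩

variable {g g' : (Fin 2 → ℝ) → Matrix (Fin 2) (Fin 2) ℝ} {A A' : (Fin 2 → ℝ) → Matrix ν (Fin 2) ℝ}
  {G G' : (Fin 2 → ℝ) → Matrix ν ν ℝ}

/-- The behaviour of the twist under a change of adapted coordinates. -/
theorem kkTwist_coordinate_change {φ : (Fin 2 → ℝ) → Fin 2 → ℝ} {s : (Fin 2 → ℝ) → ν → ℝ}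
    {L : Matrix ν ν ℝ} {y : Fin 2 → ℝ}
    (hA : ∀ I α, DifferentiableAt ℝ (fun w => A w I α) (φ y))
    (hG' : ∀ᶠ w in 𝓝 y, (G' w).det ≠ 0)
    (hφ : ∀ γ, ContDiffAt ℝ ∞ (fun w => φ w γ) y) (hs : ∀ I, ContDiffAt ℝ ∞ (fun w => s w I) y)
    (hL : |L.det| = 1)
    (h : ∀ᶠ w in 𝓝 y, kkMatrix (g' w) (A' w) (G' w)
      = (Matrix.fromBlocks (jacobian φ w) 0 (jacobian s w) L).transpose *
        kkMatrix (g (φ w)) (A (φ w)) (G (φ w)) *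
        Matrix.fromBlocks (jacobian φ w) 0 (jacobian s w) L) (I : ν) :
    kkTwist g' A' G' I y = (jacobian φ y).det / |(jacobian φ y).det| *
      ∑ K, L K I * kkTwist g A G K (φ y) := by
  have hinf : (∞ : WithTop ℕ∞) ≠ 0 := by simp
  have hL0 : L.det ≠ 0 := fun h0 => by simp [h0] at hL
  have hev : ∀ᶠ w in 𝓝 y, g' w = (jacobian φ w).transpose * g (φ w) * jacobian φ w ∧
      A' w = L⁻¹ * (A (φ w) * jacobian φ w + jacobian s w) ∧
      G' w = L.transpose * G (φ w) * L := by
    filter_upwards [hG', h] with w hw1 hw2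
    rw [transpose_mul_kkMatrix_mul _ _ _ _ _ _ hL0] at hw2
    exact kkMatrix_injective hw1 hw2
  have hφd : DifferentiableAt ℝ φ y := differentiableAt_pi.2 fun γ => (hφ γ).differentiableAt hinf
  have hX : ∀ K β, DifferentiableAt ℝ
      (fun w => ∑ γ, A (φ w) K γ * jacobian φ w γ β + pd β (fun w => s w K) w) y := fun K β =>
    (DifferentiableAt.fun_sum fun γ _ => (DifferentiableAt.comp y (g := fun w => A w K γ) (hA K γ)
      hφd).mul (((hφ γ).pd β).differentiableAt hinf)).add (((hs K).pd β).differentiableAt hinf)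
  have hA' : ∀ J β α, pd α (fun w => A' w J β) y = ∑ K, L⁻¹ J K *
      pd α (fun w => ∑ γ, A (φ w) K γ * jacobian φ w γ β + pd β (fun w => s w K) w) y :=
    fun J β α => by
      have e : (fun w => A' w J β) =ᶠ[𝓝 y] fun w => ∑ K, L⁻¹ J K *
          (∑ γ, A (φ w) K γ * jacobian φ w γ β + pd β (fun w => s w K) w) := by
        filter_upwards [hev] with w hw
        rw [hw.2.1]; rfl
      rw [e.pd_eq, pd_sum α fun K _ => (hX K β).const_mul _]
      exact Finset.sum_congr rfl fun K _ => pd_const_mul α _ (hX K β)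
  -- The summand `jacobian s` of the connection is exact and does not affect the curvature.
  have hF : ∀ J, curvature A' J 0 1 y
      = ∑ K, L⁻¹ J K * ((jacobian φ y).det * curvature A K 0 1 (φ y)) := fun J => by
    rw [curvature, hA', hA', ← Finset.sum_sub_distrib]
    refine Finset.sum_congr rfl fun K _ => ?_
    rw [← mul_sub, pd_pullback_sub_pd_pullback (a := fun w => A w K) (hA K) hφ (hs K)]
    rfl
  obtain ⟨hg0, -, hG0⟩ := hev.self_of_nhds
  have hGF : ∀ I, ∑ J, G' y I J * curvature A' J 0 1 y
      = (jacobian φ y).det * ∑ K, L K I * ∑ J, G (φ y) K J * curvature A J 0 1 (φ y) := fun I => by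
    have e : (G' y).mulVec (L⁻¹.mulVec fun K => (jacobian φ y).det * curvature A K 0 1 (φ y))
        = L.transpose.mulVec ((G (φ y)).mulVec
          fun K => (jacobian φ y).det * curvature A K 0 1 (φ y)) := by
      rw [hG0, Matrix.mulVec_mulVec, Matrix.mulVec_mulVec, Matrix.mul_assoc _ L,
        Matrix.mul_nonsing_inv _ hL0.isUnit, Matrix.mul_one]
    have e' := congrFun e I
    simp only [Matrix.mulVec, dotProduct, Matrix.transpose_apply] at e'
    simp only [hF]
    rw [e']
    simp only [Finset.mul_sum]
    exact Finset.sum_congr rfl fun _ _ => Finset.sum_congr rfl fun _ _ => by ring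
  -- Here `|det L| = 1` makes the fiber volume invariant.
  have hdG : √(G' y).det = √(G (φ y)).det := by
    rw [hG0, Matrix.det_mul, Matrix.det_mul, Matrix.det_transpose, mul_right_comm, ← sq,
      ← sq_abs L.det, hL, one_pow, one_mul]
  -- The area form acquires the absolute value of the Jacobian, whereas `F` acquired the Jacobian
  -- itself; their quotient is the sign.
  have hdg : √(g' y).det = |(jacobian φ y).det| * √(g (φ y)).det := by
    rw [hg0, Matrix.det_mul, Matrix.det_mul, Matrix.det_transpose, mul_right_comm, ← sq,
      Real.sqrt_mul (sq_nonneg _), Real.sqrt_sq_eq_abs]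
  simp only [kkTwist, ← mul_div_assoc, ← Finset.sum_div, hGF, hdG, hdg]
  have e : ∀ X : ν → ℝ, ∑ K, L K I * (√(G (φ y)).det * X K)
      = √(G (φ y)).det * ∑ K, L K I * X K := fun X => by
    rw [Finset.mul_sum]
    exact Finset.sum_congr rfl fun K _ => by ring
  rw [e]
  ring

end CoordinateChange

/-- The matrix of a linear map in the standard basis. -/
noncomputable def stdMatrix {n : ℕ}
    (T : EuclideanSpace ℝ (Fin n) →L[ℝ] EuclideanSpace ℝ (Fin n)) : Matrix (Fin n) (Fin n) ℝ :=
  Matrix.of fun k i => T (EuclideanSpace.single i 1) k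

lemma det_stdMatrix {n : ℕ} (T : EuclideanSpace ℝ (Fin n) →L[ℝ] EuclideanSpace ℝ (Fin n)) :
    (stdMatrix T).det = T.det := by
  have : stdMatrix T = LinearMap.toMatrix (EuclideanSpace.basisFun (Fin n) ℝ).toBasis
      (EuclideanSpace.basisFun (Fin n) ℝ).toBasis (T : _ →ₗ[ℝ] _) := by
    ext k i
    simp [stdMatrix, LinearMap.toMatrix_apply]
  rw [this, LinearMap.det_toMatrix]

/-! ### Comparing two systems of adapted coordinates -/

namespace TwistedBundle

variable {ι : Type*} {n N : ℕ} {B 𝒢 M : Type*}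
  [TopologicalSpace B] [ChartedSpace (EuclideanSpace ℝ (Fin n)) B] [IsManifold (𝓡 n) ∞ B]
  [AddCommGroup 𝒢] [TopologicalSpace 𝒢] [ChartedSpace (EuclideanSpace ℝ (Fin N)) 𝒢]
  [LieAddGroup (𝓡 N) ∞ 𝒢]
  [TopologicalSpace M] [ChartedSpace (EuclideanSpace ℝ (Fin (n + N))) M]
  [IsManifold (𝓡 (n + N)) ∞ M] {P : TwistedBundle ι n N B 𝒢 M} {gbar : SmoothMetric (n + N) M}

namespace AdaptedCoords

/-- An automorphism intertwines the exponential map with its differential: both sides are smooth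
homomorphisms in `v` with the same differential at `0`. -/
lemma aut_lin (C C' : P.AdaptedCoords) {i j : ι} {b : B}
    (hb : b ∈ (P.triv i).baseSet ∩ (P.triv j).baseSet) (v : EuclideanSpace ℝ (Fin N)) :
    P.aut i j b (C'.lin v) = C.lin (P.linAut i j b v) := by
  have hinf : (∞ : WithTop ℕ∞) ≠ 0 := by simp
  have ha := (P.contMDiff_aut i j b hb).1
  have hL : ContMDiff (𝓡 N) (𝓡 N) ∞ (P.linAut i j b) := (P.linAut i j b).contDiff.contMDiff
  have key := AddMonoidHom.eq_of_mfderiv_eq ((P.aut i j b).toAddMonoidHom.comp C'.lin)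
    (C.lin.comp (P.linAut i j b).toLinearMap.toAddMonoidHom)
    (ha.comp C'.contMDiff_lin) (C.contMDiff_lin.comp hL) ?_
  · exact DFunLike.congr_fun key v
  intro v
  have h1 := ((ha.mdifferentiableAt (x := C'.lin 0) hinf).hasMFDerivAt.comp 0
    (C'.contMDiff_lin.mdifferentiableAt (x := 0) hinf).hasMFDerivAt).mfderiv
  have h2 := ((C.contMDiff_lin.mdifferentiableAt (x := P.linAut i j b 0) hinf).hasMFDerivAt.comp 0
    (hL.mdifferentiableAt (x := 0) hinf).hasMFDerivAt).mfderiv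
  let Da : 𝒢 → (EuclideanSpace ℝ (Fin N) →L[ℝ] EuclideanSpace ℝ (Fin N)) := fun x =>
    mfderiv (𝓡 N) (𝓡 N) (P.aut i j b) x
  let Dl : EuclideanSpace ℝ (Fin N) → (EuclideanSpace ℝ (Fin N) →L[ℝ] EuclideanSpace ℝ (Fin N)) :=
    fun x => mfderiv (𝓡 N) (𝓡 N) C.lin x
  have e1 : mfderiv (𝓡 N) (𝓡 N) (P.aut i j b ∘ C'.lin) 0 v
      = Da (C'.lin 0) (mfderiv (𝓡 N) (𝓡 N) C'.lin 0 v) := congrArg (fun T => T v) h1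
  have e2 : mfderiv (𝓡 N) (𝓡 N) (C.lin ∘ P.linAut i j b) 0 v
      = Dl (P.linAut i j b 0) (mfderiv (𝓡 N) (𝓡 N) (P.linAut i j b) 0 v) :=
    congrArg (fun T => T v) h2
  have e3 : mfderiv (𝓡 N) (𝓡 N) (P.linAut i j b) 0 = P.linAut i j b := by
    rw [mfderiv_eq_fderiv]
    exact (P.linAut i j b).hasFDerivAt.fderiv
  rw [C'.mfderiv_lin, map_zero] at e1
  rw [map_zero, e3] at e2
  exact e1.trans ((C.mfderiv_lin _).symm.trans e2.symm)

/-- The coordinate change on the base. -/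
noncomputable def baseChange (C C' : P.AdaptedCoords) (y : Fin n → ℝ) : Fin n → ℝ :=
  WithLp.ofLp (C.chart (C'.point y))

variable {C C' : P.AdaptedCoords} {y : Fin n → ℝ}

lemma point_baseChange (h : C'.point y ∈ C.chart.source) :
    C.point (baseChange C C' y) = C'.point y :=
  C.chart.left_inv h

lemma baseChange_mem_domain (h : C'.point y ∈ C.chart.source)
    (h' : C'.point y ∈ (P.triv C.idx).baseSet) : baseChange C C' y ∈ C.domain :=
  ⟨C.chart.map_source h, by rwa [point_baseChange h]⟩

lemma contDiffAt_baseChange (hy : y ∈ C'.domain) (h : C'.point y ∈ C.chart.source) :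
    ContDiffAt ℝ ∞ (baseChange C C') y :=
  ((PiLp.contDiff_ofLp (p := 2)).contMDiff.contMDiffAt.comp y
    ((contMDiffAt_of_mem_maximalAtlas C.chart_mem h).comp y (C'.contMDiffAt_point hy))).contDiffAt

/-- Two systems of adapted coordinates differ by a change of the base coordinates, an affine change
of the fiber coordinates, and an isometry of the local group action. -/
lemma exists_param_change (hy : y ∈ C'.domain) (h : C'.point y ∈ C.chart.source)
    (h' : C'.point y ∈ (P.triv C.idx).baseSet) :
    ∃ (s : (Fin n → ℝ) → EuclideanSpace ℝ (Fin N)) (c : 𝒢), ContDiffAt ℝ ∞ s y ∧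
      ∀ᶠ w in 𝓝 y, ∀ x : Fin N → ℝ, C'.param (Sum.elim w x) = P.act C.idx c (C.param
        (Sum.elim (baseChange C C' w)
          (WithLp.ofLp (P.linAut C.idx C'.idx (C'.point y) (WithLp.toLp 2 x) + s w)))) := by
  obtain ⟨l, hl, -, -, hl2⟩ := C.exists_lin_inverse
  -- The value of the shift at the center is split off and acts as an isometry. The remaining shift
  -- is close to `0`, where its logarithm is defined and smooth.
  set c := P.shift C.idx C'.idx (C'.point y) with hc
  have hpt : ContinuousAt C'.point y := (C'.contMDiffAt_point hy).continuousAt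
  have hopen : IsOpen ((P.triv C.idx).baseSet ∩ (P.triv C'.idx).baseSet) :=
    (P.triv C.idx).open_baseSet.inter (P.triv C'.idx).open_baseSet
  have hbb : C'.point y ∈ (P.triv C.idx).baseSet ∩ (P.triv C'.idx).baseSet := ⟨h', hy.2⟩
  have hsh : ContMDiffAt 𝓘(ℝ, Fin n → ℝ) (𝓡 N) ∞
      (fun w => P.shift C.idx C'.idx (C'.point w) - c) y :=
    (((P.contMDiffOn_shift C.idx C'.idx).contMDiffAt (hopen.mem_nhds hbb)).comp y
      (C'.contMDiffAt_point hy)).sub contMDiffAt_const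
  have hsh0 : P.shift C.idx C'.idx (C'.point y) - c = 0 := sub_self c
  refine ⟨fun w => l (P.shift C.idx C'.idx (C'.point w) - c), c, ?_, ?_⟩
  · exact (ContMDiffAt.comp y (g := l) (by rw [hsh0]; exact hl) hsh).contDiffAt
  have e1 : ∀ᶠ w in 𝓝 y, C.lin (l (P.shift C.idx C'.idx (C'.point w) - c))
      = P.shift C.idx C'.idx (C'.point w) - c := by
    have := hsh.continuousAt.tendsto
    rw [hsh0] at this
    exact this.eventually hl2
  filter_upwards [e1, hpt.eventually_mem (hopen.mem_nhds hbb),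
    hpt.eventually (P.aut_locallyConstant _ _ _ hbb),
    hpt.eventually_mem (C.chart.open_source.mem_nhds h)] with w hw1 hw2 hw3 hw4 x
  have hL : C'.param (Sum.elim w x) = (P.triv C'.idx).toOpenPartialHomeomorph.symm
    (C'.point w, C'.lin (WithLp.toLp 2 x)) := rfl
  have hR : C.param (Sum.elim (baseChange C C' w)
      (WithLp.ofLp (P.linAut C.idx C'.idx (C'.point y) (WithLp.toLp 2 x) +
        l (P.shift C.idx C'.idx (C'.point w) - c))))
      = (P.triv C.idx).toOpenPartialHomeomorph.symm (C.point (baseChange C C' w),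
        C.lin (P.linAut C.idx C'.idx (C'.point y) (WithLp.toLp 2 x) +
          l (P.shift C.idx C'.idx (C'.point w) - c))) := rfl
  rw [hL, hR, point_baseChange hw4, P.act_symm hw2.1, P.transition _ _ _ hw2, hw3, map_add, hw1,
    C.aut_lin C' hbb]
  congr 2
  abel

/-- The transformation of the metric under a change of adapted coordinates. -/
lemma exists_metric_change (hinv : P.IsInvariant gbar) (hy : y ∈ C'.domain)
    (h : C'.point y ∈ C.chart.source) (h' : C'.point y ∈ (P.triv C.idx).baseSet) :
    ∃ s : (Fin n → ℝ) → Fin N → ℝ, ContDiffAt ℝ ∞ s y ∧ ∀ᶠ w in 𝓝 y, C'.metric gbar w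
      = (Matrix.fromBlocks (jacobian (baseChange C C') w) 0 (jacobian s w)
          (stdMatrix (P.linAut C.idx C'.idx (C'.point y)))).transpose *
        C.metric gbar (baseChange C C' w) *
        Matrix.fromBlocks (jacobian (baseChange C C') w) 0 (jacobian s w)
          (stdMatrix (P.linAut C.idx C'.idx (C'.point y))) := by
  obtain ⟨s, c, hs, hev⟩ := exists_param_change hy h h'
  set T := P.linAut C.idx C'.idx (C'.point y) with hT
  have hs' : ContDiffAt ℝ ∞ (fun w => WithLp.ofLp (s w)) y :=
    (PiLp.contDiff_ofLp (p := 2)).contDiffAt.comp y hs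
  refine ⟨fun w => WithLp.ofLp (s w), hs', ?_⟩
  have hpt : ContinuousAt C'.point y := (C'.contMDiffAt_point hy).continuousAt
  -- Smoothness at the single point `y` does not give order `∞` on one neighborhood, but order `1`
  -- does persist nearby.
  have hsd : ∀ᶠ w in 𝓝 y, DifferentiableAt ℝ (fun w => WithLp.ofLp (s w)) w :=
    ((hs'.of_le (m := 1) (WithTop.coe_le_coe.2 le_top)).eventually (by simp)).mono fun w hw =>
      hw.differentiableAt one_ne_zero
  filter_upwards [hev.eventually_nhds, hsd, C'.isOpen_domain.mem_nhds hy,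
    hpt.eventually_mem (C.chart.open_source.mem_nhds h),
    hpt.eventually_mem ((P.triv C.idx).open_baseSet.mem_nhds h')] with w hw1 hw2 hw3 hw4 hw5
  have hφd : DifferentiableAt ℝ (baseChange C C') w :=
    (contDiffAt_baseChange hw3 hw4).differentiableAt (by simp)
  let θ : (Fin n ⊕ Fin N → ℝ) → Fin n ⊕ Fin N → ℝ := fun z => Sum.elim
    (baseChange C C' (baseCoord (Fin n) (Fin N) z))
    (WithLp.ofLp (T (WithLp.toLp 2 fun I => z (Sum.inr I)) + s (baseCoord (Fin n) (Fin N) z)))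
  let z : Fin n ⊕ Fin N → ℝ := Sum.elim w 0
  have hbz : baseCoord (Fin n) (Fin N) z = w := rfl
  have heq : C'.param =ᶠ[𝓝 z] P.act C.idx c ∘ C.param ∘ θ := by
    have : ∀ᶠ u in 𝓝 z, ∀ x : Fin N → ℝ, C'.param (Sum.elim (baseCoord (Fin n) (Fin N) u) x)
        = P.act C.idx c (C.param (Sum.elim (baseChange C C' (baseCoord (Fin n) (Fin N) u))
          (WithLp.ofLp (T (WithLp.toLp 2 x) + s (baseCoord (Fin n) (Fin N) u))))) :=
      ((baseCoord (Fin n) (Fin N)).continuous.continuousAt (x := z)).eventually hw1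
    filter_upwards [this] with u hu
    have hu' : u = Sum.elim (baseCoord (Fin n) (Fin N) u) (fun I => u (Sum.inr I)) := by
      ext (α | I) <;> rfl
    conv_lhs => rw [hu']
    exact hu _
  have hbθ : baseCoord (Fin n) (Fin N) (θ z) = baseChange C C' w := rfl
  have hθz : θ z ∈ C.paramDomain := by
    rw [paramDomain, Set.mem_preimage, hbθ]
    exact baseChange_mem_domain hw4 hw5
  let T' : (Fin n ⊕ Fin N → ℝ) →L[ℝ] EuclideanSpace ℝ (Fin N) :=
    T.comp ((PiLp.continuousLinearEquiv 2 ℝ (fun _ : Fin N => ℝ)).symm.toContinuousLinearMap.comp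
      (ContinuousLinearMap.pi fun I => ContinuousLinearMap.proj (Sum.inr I)))
  -- The derivative of `θ`, block triangular because the base change does not involve the fiber
  -- coordinates.
  let θ' : (Fin n ⊕ Fin N → ℝ) →L[ℝ] (Fin n ⊕ Fin N → ℝ) := ContinuousLinearMap.pi fun k =>
    Sum.elim (fun γ => (fderiv ℝ (fun w => baseChange C C' w γ) w).comp
        (baseCoord (Fin n) (Fin N)))
      (fun I => (EuclideanSpace.proj I).comp T' +
        (fderiv ℝ (fun w => s w I) w).comp (baseCoord (Fin n) (Fin N))) k
  have hθ : HasFDerivAt θ θ' z := by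
    refine hasFDerivAt_pi.2 ?_
    rintro (γ | I)
    · exact HasFDerivAt.comp z (g := fun w => baseChange C C' w γ)
        (differentiableAt_pi.1 hφd γ).hasFDerivAt (baseCoord (Fin n) (Fin N)).hasFDerivAt
    · exact ((EuclideanSpace.proj I).comp T').hasFDerivAt.add (HasFDerivAt.comp z
        (g := fun w => s w I) (differentiableAt_pi.1 hw2 I).hasFDerivAt
        (baseCoord (Fin n) (Fin N)).hasFDerivAt)
  have hJ : ∀ a k, θ' (Pi.single k 1) a = Matrix.fromBlocks (jacobian (baseChange C C') w) 0
      (jacobian (fun w => WithLp.ofLp (s w)) w) (stdMatrix T) a k := by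
    rintro (γ | I) (α | K)
    · simp [θ', baseCoord_single_inl, jacobian, pd]
    · simp [θ', baseCoord_single_inr]
    · have : T' (Pi.single (Sum.inl α) 1) = 0 := by
        simp only [T', ContinuousLinearMap.comp_apply]
        convert map_zero T
        ext I
        simp
      simp [θ', baseCoord_single_inl, jacobian, pd, this]
    · have : T' (Pi.single (Sum.inr K) 1) = T (EuclideanSpace.single K 1) := by
        simp only [T', ContinuousLinearMap.comp_apply]
        congr 1
        ext I
        simp [Pi.single_apply]
      simp [θ', baseCoord_single_inr, stdMatrix, this]
  have hsrc := C.param_mem_source hθz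
  ext k l
  have := coordMetric_comp (gbar := gbar) heq hθ (C.mdifferentiableAt_param hθz)
    (P.mdifferentiableAt_act _ _ hsrc) (hinv C.idx c _ hsrc) k l
  rw [C.coordMetric_param_eq_metric hinv hθz, hbθ] at this
  rw [metric, this]
  simp only [hJ, Matrix.mul_apply, Matrix.transpose_apply, Finset.sum_mul]
  rw [Finset.sum_comm]
  exact Finset.sum_congr rfl fun a _ => Finset.sum_congr rfl fun b _ => by ring

end AdaptedCoords

end TwistedBundle

/-! ### Change of the twist, and the sign of the Jacobian -/

namespace TwistedBundle

variable {ι : Type*} {N : ℕ} {B 𝒢 M : Type*}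
  [TopologicalSpace B] [ChartedSpace (EuclideanSpace ℝ (Fin 2)) B] [IsManifold (𝓡 2) ∞ B]
  [AddCommGroup 𝒢] [TopologicalSpace 𝒢] [ChartedSpace (EuclideanSpace ℝ (Fin N)) 𝒢]
  [LieAddGroup (𝓡 N) ∞ 𝒢]
  [TopologicalSpace M] [ChartedSpace (EuclideanSpace ℝ (Fin (2 + N))) M]
  [IsManifold (𝓡 (2 + N)) ∞ M] {P : TwistedBundle ι 2 N B 𝒢 M} {gbar : SmoothMetric (2 + N) M}

namespace AdaptedCoords

variable {C C' : P.AdaptedCoords} {y : Fin 2 → ℝ}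

/-- The twist is a section of `e*`, up to the sign of the Jacobian of the base coordinates. -/
theorem twist_change (hdet : P.HasDetOne) (hinv : P.IsInvariant gbar) (hy : y ∈ C'.domain)
    (h : C'.point y ∈ C.chart.source) (h' : C'.point y ∈ (P.triv C.idx).baseSet) (I : Fin N) :
    C'.twist gbar I y = (jacobian (baseChange C C') y).det / |(jacobian (baseChange C C') y).det| *
      ∑ K, P.linAut C.idx C'.idx (C'.point y) (EuclideanSpace.single I 1) K *
        C.twist gbar K (baseChange C C' y) := by
  have hinf : (∞ : WithTop ℕ∞) ≠ 0 := by simp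
  obtain ⟨s, hs, hev⟩ := exists_metric_change (gbar := gbar) hinv hy h h'
  have hpt : ContinuousAt C'.point y := (C'.contMDiffAt_point hy).continuousAt
  refine kkTwist_coordinate_change (g := C.g gbar) (A := C.A gbar) (G := C.G gbar)
    (g' := C'.g gbar) (A' := C'.A gbar) (G' := C'.G gbar) (s := s)
    (L := stdMatrix (P.linAut C.idx C'.idx (C'.point y))) (φ := baseChange C C')
    (fun I α => (C.contDiffAt_A gbar (baseChange_mem_domain h h') I α).differentiableAt hinf)
    ?_ (contDiffAt_pi.1 (contDiffAt_baseChange hy h)) (contDiffAt_pi.1 hs) ?_ ?_ I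
  · filter_upwards [C'.isOpen_domain.mem_nhds hy] with w hw using (C'.posDef_G gbar hw).det_pos.ne'
  · rw [det_stdMatrix]
    exact hdet _ _ _ ⟨h', hy.2⟩
  · filter_upwards [hev, C'.isOpen_domain.mem_nhds hy,
      hpt.eventually_mem (C.chart.open_source.mem_nhds h),
      hpt.eventually_mem ((P.triv C.idx).open_baseSet.mem_nhds h')] with w hw1 hw2 hw3 hw4
    rwa [← C'.metric_eq_kkMatrix gbar hw2,
      ← C.metric_eq_kkMatrix gbar (baseChange_mem_domain hw3 hw4)]

/-- The Gram matrices are related by a congruence with a block triangular matrix that has this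
Jacobian as a diagonal block, and they are nondegenerate. -/
lemma det_jacobian_baseChange_ne_zero (hinv : P.IsInvariant gbar) (hy : y ∈ C'.domain)
    (h : C'.point y ∈ C.chart.source) (h' : C'.point y ∈ (P.triv C.idx).baseSet) :
    (jacobian (baseChange C C') y).det ≠ 0 := by
  obtain ⟨s, hs, hev⟩ := exists_metric_change (gbar := gbar) hinv hy h h'
  intro h0
  have h1 := (C'.posDef_metric gbar hy).det_pos
  rw [hev.self_of_nhds, Matrix.det_mul, Matrix.det_mul, Matrix.det_fromBlocks_zero₁₂, h0] at h1
  simp at h1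

lemma det_jacobian_baseChange_pos {o : OrientedAtlas 2 B} (hC : C.chart ∈ o.charts)
    (hC' : C'.chart ∈ o.charts) (hy : y ∈ C'.domain) (h : C'.point y ∈ C.chart.source) :
    0 < (jacobian (baseChange C C') y).det := by
  have h1 := o.det_pos _ hC' _ hC (WithLp.toLp 2 y) ⟨hy.1, h⟩
  rw [← det_stdMatrix] at h1
  have hF : DifferentiableAt ℝ (C.chart ∘ C'.chart.symm) (WithLp.toLp 2 y) :=
    ((contMDiffAt_of_mem_maximalAtlas C.chart_mem h).comp (WithLp.toLp 2 y)
      (contMDiffAt_symm_of_mem_maximalAtlas C'.chart_mem hy.1)).contDiffAt.differentiableAt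
        (by simp)
  convert h1 using 2
  ext γ α
  have h2 : HasFDerivAt (fun w => baseChange C C' w γ)
      ((EuclideanSpace.proj γ).comp ((fderiv ℝ (C.chart ∘ C'.chart.symm) (WithLp.toLp 2 y)).comp
        (PiLp.continuousLinearEquiv 2 ℝ (fun _ : Fin 2 => ℝ)).symm.toContinuousLinearMap)) y :=
    (EuclideanSpace.proj (𝕜 := ℝ) γ).hasFDerivAt.comp y (HasFDerivAt.comp y
      (g := C.chart ∘ C'.chart.symm) hF.hasFDerivAt
      (PiLp.continuousLinearEquiv 2 ℝ (fun _ : Fin 2 => ℝ)).symm.hasFDerivAt)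
  simp only [jacobian, Matrix.of_apply, pd, h2.fderiv, stdMatrix]
  rfl

end AdaptedCoords

end TwistedBundle

namespace TwistedBundle

variable {ι : Type*} {n N : ℕ} {B 𝒢 M : Type*}
  [TopologicalSpace B] [ChartedSpace (EuclideanSpace ℝ (Fin n)) B] [IsManifold (𝓡 n) ∞ B]
  [AddCommGroup 𝒢] [TopologicalSpace 𝒢] [ChartedSpace (EuclideanSpace ℝ (Fin N)) 𝒢]
  [LieAddGroup (𝓡 N) ∞ 𝒢]
  [TopologicalSpace M] [ChartedSpace (EuclideanSpace ℝ (Fin (n + N))) M]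
  [IsManifold (𝓡 (n + N)) ∞ M]

/-- The transition law from a trivialization to itself, evaluated at `0` and then at `x`, forces the
shift to be `0` and the automorphism to be the identity. -/
lemma linAut_self (P : TwistedBundle ι n N B 𝒢 M) {i : ι} {b : B} (hb : b ∈ (P.triv i).baseSet) :
    P.linAut i i b = ContinuousLinearMap.id ℝ _ := by
  have h1 : ∀ x : 𝒢, x = P.shift i i b + P.aut i i b x := fun x => by
    have h := congrArg (fun p => (P.triv i p).2) (P.transition i i b ⟨hb, hb⟩ x)
    simpa only [P.triv_apply_symm hb] using h
  have h2 : P.shift i i b = 0 := by simpa using (h1 0).symm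
  have h3 : (P.aut i i b : 𝒢 → 𝒢) = id := by
    funext x
    simpa [h2] using (h1 x).symm
  rw [linAut, h3]
  exact mfderiv_id

end TwistedBundle

/-! ### From local twists to flat sections and monodromy -/

namespace TwistedBundle

variable {ι : Type*} {N : ℕ} {B 𝒢 M : Type*}
  [TopologicalSpace B] [ChartedSpace (EuclideanSpace ℝ (Fin 2)) B] [IsManifold (𝓡 2) ∞ B]
  [AddCommGroup 𝒢] [TopologicalSpace 𝒢] [ChartedSpace (EuclideanSpace ℝ (Fin N)) 𝒢]
  [LieAddGroup (𝓡 N) ∞ 𝒢]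
  [TopologicalSpace M] [ChartedSpace (EuclideanSpace ℝ (Fin (2 + N))) M]
  [IsManifold (𝓡 (2 + N)) ∞ M] {P : TwistedBundle ι 2 N B 𝒢 M} {gbar : SmoothMetric (2 + N) M}

namespace AdaptedCoords

variable {C C' : P.AdaptedCoords} {y : Fin 2 → ℝ}

/-- The value of the twist in the dual of the Lie algebra. -/
noncomputable def twistForm (C : P.AdaptedCoords) (gbar : SmoothMetric (2 + N) M)
    (y : Fin 2 → ℝ) : Module.Dual ℝ (EuclideanSpace ℝ (Fin N)) :=
  ∑ K, C.twist gbar K y • (EuclideanSpace.proj K : EuclideanSpace ℝ (Fin N) →L[ℝ] ℝ).toLinearMap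

lemma twistForm_apply (C : P.AdaptedCoords) (y : Fin 2 → ℝ) (v : EuclideanSpace ℝ (Fin N)) :
    C.twistForm gbar y v = ∑ K, C.twist gbar K y * v K := by
  simp [twistForm, LinearMap.sum_apply]

lemma twistForm_single (C : P.AdaptedCoords) (y : Fin 2 → ℝ) (I : Fin N) :
    C.twistForm gbar y (EuclideanSpace.single I 1) = C.twist gbar I y := by
  simp [twistForm_apply]

lemma dual_ext {f g : Module.Dual ℝ (EuclideanSpace ℝ (Fin N))}
    (h : ∀ I, f (EuclideanSpace.single I 1) = g (EuclideanSpace.single I 1)) : f = g :=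
  (EuclideanSpace.basisFun (Fin N) ℝ).toBasis.ext fun I => by simpa using h I

lemma twistForm_change (hdet : P.HasDetOne) (hinv : P.IsInvariant gbar) (hy : y ∈ C'.domain)
    (h : C'.point y ∈ C.chart.source) (h' : C'.point y ∈ (P.triv C.idx).baseSet) :
    C'.twistForm gbar y =
      ((jacobian (baseChange C C') y).det / |(jacobian (baseChange C C') y).det|) •
        (C.twistForm gbar (baseChange C C' y) ∘ₗ
          (P.linAut C.idx C'.idx (C'.point y) : _ →ₗ[ℝ] _)) := by
  refine dual_ext fun I => ?_
  rw [twistForm_single, twist_change hdet hinv hy h h']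
  simp only [LinearMap.smul_apply, LinearMap.comp_apply, twistForm_apply, smul_eq_mul,
    ContinuousLinearMap.coe_coe]
  exact congrArg _ (Finset.sum_congr rfl fun K _ => mul_comm _ _)

lemma twistForm_change_of_oriented {o : OrientedAtlas 2 B} (hdet : P.HasDetOne)
    (hinv : P.IsInvariant gbar) (hC : C.chart ∈ o.charts) (hC' : C'.chart ∈ o.charts)
    (hy : y ∈ C'.domain) (h : C'.point y ∈ C.chart.source)
    (h' : C'.point y ∈ (P.triv C.idx).baseSet) :
    C'.twistForm gbar y = C.twistForm gbar (baseChange C C' y) ∘ₗ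
          (P.linAut C.idx C'.idx (C'.point y) : _ →ₗ[ℝ] _) := by
  have hd := det_jacobian_baseChange_pos hC hC' hy h
  rw [twistForm_change hdet hinv hy h h', abs_of_pos hd, div_self hd.ne', one_smul]

lemma ofLp_chart_mem_domain {b : B} (h : b ∈ C.chart.source) (h' : b ∈ (P.triv C.idx).baseSet) :
    C.point (WithLp.ofLp (C.chart b)) = b ∧ WithLp.ofLp (C.chart b) ∈ C.domain := by
  have h1 : C.point (WithLp.ofLp (C.chart b)) = b := C.chart.left_inv h
  exact ⟨h1, C.chart.map_source h, by rwa [h1]⟩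

lemma eventually_twistForm_eq (C : P.AdaptedCoords)
    (h : ∀ y ∈ C.domain, ∀ I k, pd k (C.twist gbar I) y = 0) (hy : y ∈ C.domain) :
    ∀ᶠ w in 𝓝 y, C.twistForm gbar w = C.twistForm gbar y := by
  obtain ⟨r, hr, hb⟩ := Metric.isOpen_iff.1 C.isOpen_domain y hy
  filter_upwards [Metric.ball_mem_nhds y hr] with w hw
  refine dual_ext fun I => ?_
  rw [twistForm_single, twistForm_single]
  exact Metric.isOpen_ball.is_const_of_fderiv_eq_zero (convex_ball y r).isPreconnected
    (fun u hu => ((C.contDiffAt_twist gbar (hb hu) I).differentiableAt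
      (by simp)).differentiableWithinAt)
    (fun u hu => fderiv_eq_zero_of_pd (h u (hb hu) I)) hw (Metric.mem_ball_self hr)

lemma continuousAt_det_jacobian_baseChange (hy : y ∈ C'.domain) (h : C'.point y ∈ C.chart.source) :
    ContinuousAt (fun w => (jacobian (baseChange C C') w).det) y := by
  have h1 := contDiffAt_pi.1 (contDiffAt_baseChange hy h)
  have h2 : ContinuousAt (jacobian (baseChange C C')) y :=
    continuousAt_pi.2 fun γ => continuousAt_pi.2 fun α => ((h1 γ).pd α).continuousAt
  exact (continuous_id.matrix_det.continuousAt).comp h2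

end AdaptedCoords

open AdaptedCoords

variable {o : OrientedAtlas 2 B}
  {σ : ι → B → Module.Dual ℝ (EuclideanSpace ℝ (Fin N))}

/-- In arbitrary adapted coordinates the twist is given by the section `σ` up to a sign. -/
lemma exists_twistForm_eq_smul (hdet : P.HasDetOne) (hinv : P.IsInvariant gbar)
    (hσ : ∀ C : P.AdaptedCoords, C.chart ∈ o.charts → ∀ y ∈ C.domain, ∀ I,
      σ C.idx (C.point y) (EuclideanSpace.single I 1) = C.twist gbar I y)
    (C : P.AdaptedCoords) {y : Fin 2 → ℝ} (hy : y ∈ C.domain) :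
    ∃ ε : ℝ, ∀ᶠ w in 𝓝 y, C.twistForm gbar w = ε • σ C.idx (C.point w) := by
  obtain ⟨β, hβ, hb⟩ := o.exists_mem_source (C.point y)
  -- Only the base chart is replaced by an oriented one, so `linAut` is the identity and the
  -- coordinate change contributes just the sign of the Jacobian, which is constant near `y`.
  let C₁ : P.AdaptedCoords := { C with chart := β, chart_mem := o.subset_maximalAtlas hβ }
  have hb' : C.point y ∈ C₁.chart.source := hb
  have key : ∀ w ∈ C.domain, C.point w ∈ β.source → C.twistForm gbar w =
      ((jacobian (baseChange C₁ C) w).det / |(jacobian (baseChange C₁ C) w).det|) •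
        σ C.idx (C.point w) := by
    intro w hw hwβ
    have h1 : C.point w ∈ (P.triv C₁.idx).baseSet := hw.2
    rw [twistForm_change (C := C₁) hdet hinv hw hwβ h1]
    have h2 : P.linAut C₁.idx C.idx (C.point w) = ContinuousLinearMap.id ℝ _ := P.linAut_self hw.2
    have h3 : C₁.twistForm gbar (baseChange C₁ C w) = σ C.idx (C.point w) := dual_ext fun I => by
      rw [twistForm_single, ← hσ C₁ hβ _ (baseChange_mem_domain hwβ h1), point_baseChange hwβ]
    rw [h2, h3]
    rfl
  have hc := continuousAt_det_jacobian_baseChange (C := C₁) hy hb'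
  have hev : ∀ᶠ w in 𝓝 y, w ∈ C.domain ∧ C.point w ∈ β.source :=
    Filter.Eventually.and (C.isOpen_domain.mem_nhds hy)
      ((C.contMDiffAt_point hy).continuousAt.eventually_mem (β.open_source.mem_nhds hb))
  rcases (det_jacobian_baseChange_ne_zero (C := C₁) hinv hy hb' hy.2).lt_or_gt with h0 | h0
  · refine ⟨-1, ?_⟩
    filter_upwards [hev, hc.eventually_lt_const h0] with w hw hw0
    rw [key w hw.1 hw.2, abs_of_neg hw0, div_neg, div_self hw0.ne]
  · refine ⟨1, ?_⟩
    filter_upwards [hev, hc.eventually_const_lt h0] with w hw hw0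
    rw [key w hw.1 hw.2, abs_of_pos hw0, div_self hw0.ne']

/-- The section is defined pointwise from a chosen oriented chart at each point. The transformation
law makes it independent of that choice, and vanishing derivatives make it locally constant. -/
theorem MixedRicciEquation.twistIsFlat (hdet : P.HasDetOne) (hinv : P.IsInvariant gbar)
    (o : OrientedAtlas 2 B) (h : P.MixedRicciEquation gbar) : P.TwistIsFlat o gbar := by
  rw [mixedRicciEquation_iff_pd_twist hinv] at h
  -- Without adapted coordinates the condition on the section is vacuous. Otherwise `C₀` is needed
  -- only for its exponential map `lin`.
  rcases isEmpty_or_nonempty P.AdaptedCoords with hE | ⟨⟨C₀⟩⟩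
  · exact ⟨0, ⟨fun _ _ _ _ => rfl, fun _ _ _ => Filter.Eventually.of_forall fun _ => rfl⟩,
      fun C => hE.elim C⟩
  choose β hβ hb using o.exists_mem_source
  let D : ι → B → P.AdaptedCoords := fun i b =>
    { C₀ with idx := i, chart := β b, chart_mem := o.subset_maximalAtlas (hβ b) }
  let σ : ι → B → Module.Dual ℝ (EuclideanSpace ℝ (Fin N)) := fun i b =>
    (D i b).twistForm gbar (WithLp.ofLp (β b b))
  have hσ : ∀ C : P.AdaptedCoords, C.chart ∈ o.charts → ∀ y ∈ C.domain,
      σ C.idx (C.point y) = C.twistForm gbar y := by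
    intro C hC y hy
    rw [twistForm_change_of_oriented (C := D C.idx (C.point y)) (C' := C) hdet hinv (hβ _) hC hy
      (hb _) hy.2]
    have h2 : P.linAut (D C.idx (C.point y)).idx C.idx (C.point y) = ContinuousLinearMap.id ℝ _ :=
      P.linAut_self hy.2
    rw [h2]
    rfl
  refine ⟨σ, ⟨?_, ?_⟩, fun C hC y hy I => by rw [hσ C hC y hy, twistForm_single]⟩
  · intro i j b hij
    obtain ⟨hp, hd⟩ := ofLp_chart_mem_domain (C := D j b) (hb b) hij.2
    have h3 := twistForm_change_of_oriented (C := D i b) (C' := D j b) hdet hinv (hβ b) (hβ b) hd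
      (by rw [hp]; exact hb b) (by rw [hp]; exact hij.1)
    rw [baseChange, hp] at h3
    exact h3
  · intro i b hi
    obtain ⟨hp, hd⟩ := ofLp_chart_mem_domain (C := D i b) (hb b) hi
    have hcont : ContinuousAt (fun b' => WithLp.ofLp ((D i b).chart b')) b :=
      (PiLp.continuous_ofLp 2 _).continuousAt.comp ((β b).continuousAt (hb b))
    filter_upwards [hcont.eventually ((D i b).eventually_twistForm_eq (h (D i b)) hd),
      (β b).open_source.mem_nhds (hb b), (P.triv i).open_baseSet.mem_nhds hi] with b' h1 h2 h3
    obtain ⟨hp', hd'⟩ := ofLp_chart_mem_domain (C := D i b) h2 h3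
    have e' := hσ (D i b) (hβ b) _ hd'
    rw [hp', h1] at e'
    exact e'

/-- The section prescribes the twist in oriented coordinates only, while the equation concerns all
of them; the locally constant factor `ε` bridges the gap. -/
theorem TwistIsFlat.mixedRicciEquation (hdet : P.HasDetOne) (hinv : P.IsInvariant gbar)
    (h : P.TwistIsFlat o gbar) : P.MixedRicciEquation gbar := by
  obtain ⟨σ, hflat, hσ⟩ := h
  rw [mixedRicciEquation_iff_pd_twist hinv]
  intro C y hy I k
  obtain ⟨ε, hε⟩ := exists_twistForm_eq_smul hdet hinv hσ C hy
  have hc : C.twist gbar I =ᶠ[𝓝 y]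
      fun _ => ε * σ C.idx (C.point y) (EuclideanSpace.single I 1) := by
    filter_upwards [hε, (C.contMDiffAt_point hy).continuousAt.eventually
      (hflat.locallyConstant _ _ hy.2)] with w h1 h2
    rw [← twistForm_single, h1, h2]
    rfl
  rw [hc.pd_eq, pd_const]

/-- A flat section of `e*` over a connected base that vanishes at one point vanishes. -/
lemma IsFlatSection.eq_zero [ConnectedSpace B] (hflat : P.IsFlatSection σ) {i : ι} {b₀ : B}
    (hb₀ : b₀ ∈ (P.triv i).baseSet) (h₀ : σ i b₀ = 0) {j : ι} {b : B}
    (hb : b ∈ (P.triv j).baseSet) : σ j b = 0 := by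
  -- By compatibility, vanishing in one trivialization implies vanishing in all; local constancy
  -- then makes `S` open and closed.
  let S : Set B := {b | ∀ j, b ∈ (P.triv j).baseSet → σ j b = 0}
  have hS : ∀ {i b}, b ∈ (P.triv i).baseSet → (b ∈ S ↔ σ i b = 0) := fun {i b} hi =>
    ⟨fun h => h i hi, fun h j hj => by rw [hflat.compatible i j b ⟨hi, hj⟩, h, LinearMap.zero_comp]⟩
  have hloc : ∀ b, ∀ᶠ b' in 𝓝 b, (b' ∈ S ↔ b ∈ S) := fun b => by
    obtain ⟨i, hi⟩ := P.exists_mem_baseSet b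
    filter_upwards [hflat.locallyConstant i b hi, (P.triv i).open_baseSet.mem_nhds hi] with b' h1 h2
    rw [hS h2, hS hi, h1]
  have hclopen : IsClopen S := by
    refine ⟨⟨isOpen_iff_mem_nhds.2 fun b hb => ?_⟩, isOpen_iff_mem_nhds.2 fun b hb => ?_⟩
    · exact (hloc b).mono fun b' h => fun h' => hb (h.1 h')
    · exact (hloc b).mono fun b' h => h.2 hb
  have : S = Set.univ := hclopen.eq_univ ⟨b₀, (hS hb₀).2 h₀⟩
  exact (this ▸ Set.mem_univ b : b ∈ S) j hb

/-- A nonzero flat section of `e*` spans a trivial subrepresentation of the monodromy. -/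
lemma IsFlatSection.hasTrivialLine (hflat : P.IsFlatSection σ) {i : ι} {b₀ : B}
    (h₀ : σ i b₀ ≠ 0) : P.HasTrivialLine i b₀ := by
  refine ⟨ℝ ∙ σ i b₀, finrank_span_singleton h₀, fun γ v hv => ?_⟩
  obtain ⟨c, rfl⟩ := Submodule.mem_span_singleton.1 hv
  refine ⟨fun j t => c • σ j (γ t), ⟨fun j k t ht => ?_, fun j t ht => ?_⟩, by simp, by simp⟩
  · rw [hflat.compatible j k _ ht, LinearMap.smul_comp]
  · exact (γ.continuous.continuousAt.eventually (hflat.locallyConstant j _ ht)).mono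
      fun s hs => congrArg (c • ·) hs

lemma AdaptedCoords.F_eq_zero_of_twist (C : P.AdaptedCoords) {y : Fin 2 → ℝ} (hy : y ∈ C.domain)
    (h : ∀ I, C.twist gbar I y = 0) (I : Fin N) (α β : Fin 2) : C.F gbar I α β y = 0 := by
  have hG := (C.posDef_G gbar hy).det_pos
  have hg := Real.sqrt_ne_zero'.2 (C.det_g_pos gbar hy)
  have h1 : (C.G gbar y).mulVec (fun J => C.F gbar J 0 1 y / √(C.g gbar y).det) = 0 := by
    funext K
    exact (mul_eq_zero.1 (h K)).resolve_left (Real.sqrt_ne_zero'.2 hG)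
  have h2 := congrFun (Matrix.eq_zero_of_mulVec_eq_zero hG.ne' h1) I
  have h3 : C.F gbar I 0 1 y = 0 := (div_eq_zero_iff.1 h2).resolve_right hg
  rw [F, sub_eq_zero] at h3 ⊢
  fin_cases α <;> fin_cases β <;> simp [h3]

end TwistedBundle

/-! ### The main theorem -/

theorem corollary2p16 {ι : Type*} {N : ℕ} (hN : 1 ≤ N) {B 𝒢 M : Type*}
    [TopologicalSpace B] [T2Space B] [SecondCountableTopology B] [ConnectedSpace B]
    [ChartedSpace (EuclideanSpace ℝ (Fin 2)) B] [IsManifold (𝓡 2) ∞ B]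
    [AddCommGroup 𝒢] [TopologicalSpace 𝒢] [T2Space 𝒢] [ConnectedSpace 𝒢]
    [ChartedSpace (EuclideanSpace ℝ (Fin N)) 𝒢] [LieAddGroup (𝓡 N) ∞ 𝒢]
    [TopologicalSpace M] [ChartedSpace (EuclideanSpace ℝ (Fin (2 + N))) M]
    [IsManifold (𝓡 (2 + N)) ∞ M]
    (P : TwistedBundle ι 2 N B 𝒢 M) (hdet : P.HasDetOne) (o : OrientedAtlas 2 B)
    (gbar : SmoothMetric (2 + N) M) (hinv : P.IsInvariant gbar) :
    (P.MixedRicciEquation gbar ↔ P.TwistIsFlat o gbar) ∧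
    ∀ lam : ℝ, IsEinstein gbar lam →
      P.MixedRicciEquation gbar ∧
      ∀ (b₀ : B) (i : ι), b₀ ∈ (P.triv i).baseSet →
        ¬ P.HasTrivialLine i b₀ → P.CurvatureVanishes gbar := by
  refine ⟨⟨fun h => h.twistIsFlat hdet hinv o, fun h => h.mixedRicciEquation hdet hinv⟩,
    fun lam hE => ⟨hE.mixedRicciEquation hinv, fun b₀ i hb₀ hline C y hy => ?_⟩⟩
  obtain ⟨σ, hflat, hσ⟩ := (hE.mixedRicciEquation hinv).twistIsFlat hdet hinv o
  have h₀ : σ i b₀ = 0 := by_contra fun h => hline (hflat.hasTrivialLine h)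
  -- The chart of `C` may be incompatible with the orientation, so the twist is compared with `σ`
  -- only up to the factor `ε`.
  obtain ⟨ε, hε⟩ := TwistedBundle.exists_twistForm_eq_smul hdet hinv hσ C hy
  refine C.F_eq_zero_of_twist hy fun I => ?_
  rw [← C.twistForm_single, hε.self_of_nhds, hflat.eq_zero hb₀ h₀ hy.2, smul_zero,
    LinearMap.zero_apply]
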